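/- **Problem OptPSR.** Let $d\ge 2$. Each agent of a finite set ranks $d$ distinct alternatives of a set $A$; the resulting profile is $\Pi$. For an alternative $x$ let $\nu_j(x,\Pi)$ be the number of agents that rank $x$ at position $j$, and for an ordered pair $(x,y)$ let $\delta(x,y,\Pi)\in\mathbb{Z}^d$ be the vector with entries $\delta_j(x,y,\Pi)=\nu_j(x,\Pi)-\nu_j(y,\Pi)$. Let $C$ be a finite set of ordered pairs of alternatives (constraints), each with a rational weight $w(x,y)\ge 0$. A scoring vector is a point of $R_0=\{s\in\mathbb{R}^d: s_1\ge s_2\ge\dots\ge s_d\ge 0\}$. The goal is to find a scoring vector $s$ that maximizes, over all scoring vectors, the gain $$g(s)=\sum_{(x,y)\in C,\ \delta(x,y,\Pi)\cdot s>0} w(x,y).$$ The input consists of $d$ (in unary) and the list, in any order and without repetition, of the weights $w(x,y)$ and the vectors $\delta(x,y,\Pi)$ for $(x,y)\in C$; its size is its bit length, with numbers in binary. **The algorithm.** It maintains a pool of regions, each given by a list of homogeneous linear inequalities ($a\cdot s>0$ or $a\cdot s\ge 0$, with $a\in\mathbb{Z}^d$) and a value $\mathrm{val}$. Initially the pool consists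 of $R_0$ with $\mathrm{val}(R_0)=0$. The constraints are considered one by one. For a constraint $(x,y)$ and each region $R$ that is in the pool when the constraint is considered, a linear programming subroutine tests the feasibility of $R^{xy}=R\cap\{\delta(x,y,\Pi)\cdot s>0\}$ and $R^{\neg xy}=R\cap\{\delta(x,y,\Pi)\cdot s\le 0\}$. If both are non-empty, they replace $R$, with values $\mathrm{val}(R)+w(x,y)$ and $\mathrm{val}(R)$; if only $R^{xy}$ is non-empty, $R$ stays and $\mathrm{val}(R)$ is increased by $w(x,y)$; otherwise nothing is changed. At the end, the algorithm returns a point of a region of maximum value, found by the subroutine. The subroutine may be any procedure that, given $d\geq 1$ and a finite system of such inequalities in $d$ variables, reports infeasibility if the system has no real solution and returns a rational solution otherwise, and that for every fixed $d$ runs in time polynomial in the bit size of the system. All running times are bit costs: every elementary operation on integers and lists costs at least one plus the bit length of the data that it reads (for a multiplication, the product of the bit lengths of the factors plus one). **Statement.** A subroutine with these properties exists. With every such subroutine, and for every constant $d\ge 2$, there is a polynomial $p$ such that on every OptPSR instance with parameter $d$ the algorithm returns a (rational) scoring vector of maximum gain after at most $p(n)$ steps, where $n$ is the size of the input. -/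

import Mathlib

namespace PSR

/-! ### Profiles, scoring vectors and the problem OptPSR -/

/-- An instance of OptPSR with agents `N`, alternatives `A` and ballots of length `d`: every agent
ranks `d` distinct alternatives (`profile i k` is the alternative at position `k` in the ballot of
agent `i`), and every constraint `(x, y)` has a non-negative weight. -/
structure Instance (d : ℕ) (N A : Type*) where
  profile : N → Fin d ↪ A
  constraints : Finset (A × A)
  weight : A × A → ℚ
  weight_nonneg : ∀ c ∈ constraints, 0 ≤ weight c

/-- Scoring vectors: `s₁ ≥ s₂ ≥ ⋯ ≥ s_d ≥ 0`. -/
def IsScoringVector {d : ℕ} (s : Fin d → ℝ) : Prop :=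
  Antitone s ∧ ∀ j, 0 ≤ s j

namespace Instance

variable {d : ℕ} {N A : Type*} [Fintype N]

/-- The number `ν_j(x, Π)` of agents that rank `x` at position `j`. -/
noncomputable def rankCount (I : Instance d N A) (x : A) (j : Fin d) : ℕ :=
  Nat.card {i : N // I.profile i j = x}

/-- The vector `δ(x, y, Π)`, with `δ_j(x, y, Π) = ν_j(x, Π) - ν_j(y, Π)`. -/
noncomputable def delta (I : Instance d N A) (c : A × A) (j : Fin d) : ℤ :=
  (I.rankCount c.1 j : ℤ) - (I.rankCount c.2 j : ℤ)

/-- The gain of `s`: the total weight of the constraints `(x, y)` with `δ(x, y, Π) · s > 0`. -/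
noncomputable def gain (I : Instance d N A) (s : Fin d → ℝ) : ℝ :=
  open Classical in
  ∑ c ∈ I.constraints, if 0 < ∑ j, (I.delta c j : ℝ) * s j then (I.weight c : ℝ) else 0

/-- `s` solves the instance: it is a scoring vector of maximum gain among all scoring vectors. -/
def IsSolution (I : Instance d N A) (s : Fin d → ℝ) : Prop :=
  IsScoringVector s ∧ ∀ t : Fin d → ℝ, IsScoringVector t → I.gain t ≤ I.gain s

end Instance

/-! ### A programming language with a bit-cost step count

Data are integers and lists (built from `nil` and `cons`).  Programs are first-order and free of
side effects; the only control structures are conditionals, local variables and loops over lists.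
Every elementary operation costs at least one plus the total bit length of the data that it
reads (a multiplication: the product of the bit lengths), including look-ups and copies of
variables, so that a run of cost `T` is simulated by a Turing machine in time polynomial in `T`. -/

/-- Data. -/
inductive Val where
  | int (z : ℤ)
  | nil
  | cons (a b : Val)

namespace Val

/-- The number of bits of a datum, up to a constant factor; integers are written in binary. -/
def size : Val → ℕ
  | int z => Nat.size z.natAbs + 1
  | nil => 1
  | cons a b => size a + size b + 1

def head : Val → Val
  | cons a _ => a
  | _ => nil

def tail : Val → Val
  | cons _ b => b
  | _ => nil

def toInt : Val → ℤ
  | int z => z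
  | _ => 0

def isNil : Val → Bool
  | nil => true
  | _ => false

/-- The datum that represents a list of data. -/
def ofList : List Val → Val
  | [] => nil
  | a :: l => cons a (ofList l)

/-- A loop that goes through a list from its last entry to its first one.  The accumulator starts
as `init`; the body `f` gets the current entry and the accumulator and returns the new accumulator.
Second components count steps. -/
def loop (f : Val → Val → Val × ℕ) (init : Val × ℕ) : Val → Val × ℕ
  | cons a b =>
    let r := loop f init b
    let q := f a r.1
    (q.1, r.2 + q.2 + a.size + r.1.size + 1)
  | _ => init

end Val

/-- Programs; variables are named by natural numbers. -/
inductive Prog where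
  | var (x : ℕ)
  | lit (z : ℤ)
  | nil
  | cons (p q : Prog)
  | head (p : Prog)
  | tail (p : Prog)
  | add (p q : Prog)
  | sub (p q : Prog)
  | mul (p q : Prog)
  /-- `ifPos c p q`: if the integer `c` is positive then `p` else `q`. -/
  | ifPos (c p q : Prog)
  /-- `ifNil c p q`: if `c` is the empty list then `p` else `q`. -/
  | ifNil (c p q : Prog)
  /-- `bind x p q`: store the result of `p` in the local variable `x`, then run `q`. -/
  | bind (x : ℕ) (p q : Prog)
  /-- `loop x y l init body`: run `body` for all entries `x` of the list `l`, last entry first,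
  with accumulator `y`, which starts as `init`. -/
  | loop (x y : ℕ) (l init body : Prog)

/-- The values of the variables. -/
abbrev Env := ℕ → Val

namespace Prog

/-- The result of a program and the number of steps that it takes. -/
def run : Prog → Env → Val × ℕ
  | var x, ρ => (ρ x, (ρ x).size + 1)
  | lit z, _ => (.int z, (Val.int z).size + 1)
  | nil, _ => (.nil, 2)
  | cons p q, ρ =>
    let a := p.run ρ
    let b := q.run ρ
    (.cons a.1 b.1, a.2 + b.2 + a.1.size + b.1.size + 1)
  | head p, ρ =>
    let a := p.run ρ
    (a.1.head, a.2 + a.1.size + 1)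
  | tail p, ρ =>
    let a := p.run ρ
    (a.1.tail, a.2 + a.1.size + 1)
  | add p q, ρ =>
    let a := p.run ρ
    let b := q.run ρ
    (.int (a.1.toInt + b.1.toInt), a.2 + b.2 + a.1.size + b.1.size + 1)
  | sub p q, ρ =>
    let a := p.run ρ
    let b := q.run ρ
    (.int (a.1.toInt - b.1.toInt), a.2 + b.2 + a.1.size + b.1.size + 1)
  | mul p q, ρ =>
    let a := p.run ρ
    let b := q.run ρ
    (.int (a.1.toInt * b.1.toInt), a.2 + b.2 + a.1.size * b.1.size + 1)
  | ifPos c p q, ρ =>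
    let a := c.run ρ
    let b := if 0 < a.1.toInt then p.run ρ else q.run ρ
    (b.1, a.2 + b.2 + a.1.size + 1)
  | ifNil c p q, ρ =>
    let a := c.run ρ
    let b := if a.1.isNil then p.run ρ else q.run ρ
    (b.1, a.2 + b.2 + a.1.size + 1)
  | bind x p q, ρ =>
    let a := p.run ρ
    let b := q.run (Function.update ρ x a.1)
    (b.1, a.2 + b.2 + a.1.size + 1)
  | loop x y l init body, ρ =>
    let a := l.run ρ
    let b := init.run ρ
    let r := Val.loop (fun e acc => body.run (Function.update (Function.update ρ x e) y acc)) b a.1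
    (r.1, a.2 + r.2 + a.1.size + b.1.size + 1)

end Prog

/-! ### Representation of inputs and outputs -/

/-- An integer vector, as the list of its entries. -/
def encInts {d : ℕ} (a : Fin d → ℤ) : Val :=
  Val.ofList (List.ofFn fun j => Val.int (a j))

/-- A rational number, as numerator and denominator. -/
def encRat (q : ℚ) : Val :=
  .cons (.int q.num) (.int q.den)

/-- A rational vector, as the list of its entries. -/
def encRats {d : ℕ} (s : Fin d → ℚ) : Val :=
  Val.ofList (List.ofFn fun j => encRat (s j))

/-- The list of positions `1, …, d`. -/
def encPositions (d : ℕ) : Val :=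
  encInts fun j : Fin d => (j : ℤ) + 1

/-- The input of the algorithm: the positions `1, …, d` and, for the constraints in the order in
which they are listed, the weight `w(x, y)` and the vector `δ(x, y, Π)`. -/
noncomputable def Instance.encode {d : ℕ} {N A : Type*} [Fintype N] (I : Instance d N A) (l : List (A × A)) :
    Val :=
  .cons (encPositions d) (Val.ofList (l.map fun c => .cons (encRat (I.weight c)) (encInts (I.delta c))))

/-! ### Regions and feasibility tests -/

/-- A homogeneous linear inequality in `d` variables: `a · s > 0` (if `strict`) or `a · s ≥ 0`. -/
structure Ineq (d : ℕ) where
  strict : Bool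
  coeff : Fin d → ℤ

/-- The point `s` satisfies the inequality. -/
def Ineq.Holds {d : ℕ} (c : Ineq d) (s : Fin d → ℝ) : Prop :=
  if c.strict then 0 < ∑ j, (c.coeff j : ℝ) * s j else 0 ≤ ∑ j, (c.coeff j : ℝ) * s j

/-- A system of inequalities, as the list of pairs (1 if strict and 0 if not, coefficients). -/
def encSystem {d : ℕ} (S : List (Ineq d)) : Val :=
  Val.ofList (S.map fun c => .cons (.int (if c.strict then 1 else 0)) (encInts c.coeff))

/- The variables of the algorithm. -/
abbrev vInput : ℕ := 0
abbrev vPos : ℕ := 1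
abbrev vSys : ℕ := 2
abbrev vConstr : ℕ := 3
abbrev vPool : ℕ := 4
abbrev vReg : ℕ := 5
abbrev vAcc : ℕ := 6
abbrev vRegYes : ℕ := 7
abbrev vRegNo : ℕ := 8
abbrev vYes : ℕ := 9
abbrev vNo : ℕ := 10
abbrev vI : ℕ := 11
abbrev vJ : ℕ := 12
abbrev vRow : ℕ := 13
abbrev vBest : ℕ := 14

/-- `lp` is a linear programming subroutine that is efficient in fixed dimension.  Called with the
positions `1, …, d` in the variable `vPos` and a system of inequalities in `d` variables in the
variable `vSys` (whatever the other variables hold), it returns `nil` if the system is infeasible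
over the reals and a rational solution otherwise; for every fixed `d`, its running time is
polynomial in the size of the system. -/
def IsLPSolver (lp : Prog) : Prop :=
  ∀ d : ℕ, 0 < d → ∃ q : Polynomial ℕ, ∀ (S : List (Ineq d)) (ρ : Env),
    ρ vPos = encPositions d → ρ vSys = encSystem S →
      ((¬ ∃ s : Fin d → ℝ, ∀ c ∈ S, c.Holds s) → (lp.run ρ).1 = .nil) ∧
      ((∃ s : Fin d → ℝ, ∀ c ∈ S, c.Holds s) →
        ∃ s : Fin d → ℚ, (∀ c ∈ S, c.Holds fun j => (s j : ℝ)) ∧ (lp.run ρ).1 = encRats s) ∧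
      (lp.run ρ).2 ≤ q.eval (encSystem S).size

/-! ### The algorithm

A region of the pool is represented by its gain (a numerator and a denominator) together with the
list of the inequalities that define it. -/

open Prog

/-- The region `R₀`: row `i` has `1` in column `i`, `-1` in column `i + 1` and `0` elsewhere, that is,
the rows are `s_i - s_{i+1} ≥ 0` for `i < d`, and `s_d ≥ 0`. -/
def initialRegion : Prog :=
  loop vI vAcc (var vPos) nil
    (cons
      (cons (lit 0)
        (loop vJ vRow (var vPos) nil
          (cons
            (ifPos (sub (var vJ) (var vI))
              (ifPos (sub (sub (var vJ) (var vI)) (lit 1)) (lit 0) (lit (-1)))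
              (ifPos (sub (var vI) (var vJ)) (lit 0) (lit 1)))
            (var vRow))))
      (var vAcc))

/-- The sum of two fractions. -/
def addFrac (p q : Prog) : Prog :=
  cons (add (mul (head p) (tail q)) (mul (head q) (tail p))) (mul (tail p) (tail q))

/-- The entrywise negative of an integer vector. -/
def negVec (p : Prog) : Prog :=
  loop vJ vRow p nil (cons (sub (lit 0) (var vJ)) (var vRow))

/-- The subroutine `lp`, called with the system `p`. -/
def feasible (lp p : Prog) : Prog :=
  bind vSys p lp

/-- One step of the algorithm: the new pool, from the pool `vPool` and the constraint `vConstr`.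
Every region `R` of the pool gives rise to the candidates `R ∩ {δ · s > 0}` and `R ∩ {δ · s ≤ 0}`.
If both are feasible, they replace `R`, and the weight is added to the gain of the first one; if only
the first one is feasible, `R` stays and the weight is added to its gain; otherwise `R` stays. -/
def step (lp : Prog) : Prog :=
  loop vReg vAcc (var vPool) nil
    (bind vRegYes (cons (cons (lit 1) (tail (var vConstr))) (tail (var vReg)))
    (bind vRegNo (cons (cons (lit 0) (negVec (tail (var vConstr)))) (tail (var vReg)))
    (bind vYes (feasible lp (var vRegYes))
    (bind vNo (feasible lp (var vRegNo))
      (ifNil (var vYes)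
        (cons (var vReg) (var vAcc))
        (ifNil (var vNo)
          (cons (cons (addFrac (head (var vReg)) (head (var vConstr))) (tail (var vReg))) (var vAcc))
          (cons (cons (addFrac (head (var vReg)) (head (var vConstr))) (var vRegYes))
            (cons (cons (head (var vReg)) (var vRegNo)) (var vAcc)))))))))

/-- A region of maximum gain in the pool `vPool`. -/
def bestRegion : Prog :=
  loop vReg vBest (var vPool) (head (var vPool))
    (ifPos
      (sub (mul (head (head (var vReg))) (tail (head (var vBest))))
        (mul (head (head (var vBest))) (tail (head (var vReg)))))
      (var vReg) (var vBest))

/-- The algorithm.  Starting from the pool that consists of `R₀` with gain `0 / 1`, consider the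
constraints one by one; then return a point of a region of maximum gain. -/
def algorithm (lp : Prog) : Prog :=
  bind vPos (head (var vInput))
  (bind vPool
    (loop vConstr vPool (tail (var vInput))
      (cons (cons (cons (lit 0) (lit 1)) initialRegion) nil)
      (step lp))
  (feasible lp (tail bestRegion)))

/-- The run of the algorithm on the given input: its output and its number of steps. -/
def runAlgorithm (lp : Prog) (input : Val) : Val × ℕ :=
  (algorithm lp).run (Function.update (fun _ => Val.nil) vInput input)

end PSR

/-!
The existence of a linear programming subroutine is shown by Fourier–Motzkin elimination.
Eliminating one variable from a system of `m` inequalities leaves at most quadratically many, with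
coefficients of about twice the size, so that the elimination of all variables is polynomial in fixed
dimension.  As the inequalities are homogeneous, back-substitution can be carried out with integer
vectors: a solution `t` of the eliminated system is scaled by `q > 0` and extended by `p`, where the
ray `(p, q)` is the sum of the two extreme rays of the cone that `t` leaves for it in the half-plane
`q ≥ 0` (`sat_elim`, `sat_extend`).  These steps are written as programs, whose results are computed in the
lemmas `Prog.run_…` (`isLPSolver_fourierMotzkin`).

Running times are bounded by the calculus `Prog.PolyTime`, with one rule for every construct of the
language.  The point is the treatment of loops, in which an accumulator could grow exponentially.
A loop is polynomial if its accumulator grows per iteration by an amount that does not depend on the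
accumulator (`PolyTime.loop`, which rests on the predicate `Grows`), if the number of iterations is
bounded by a constant (`PolyTime.loop_of_length_le`, for loops over the `d` positions), or if the
accumulators are known to be of polynomial size (`PolyTime.loop_of_size_le`, for the loop of the
algorithm over the constraints).

For the algorithm itself, the invariant `PoolInvariant` says that the regions of the pool are
non-empty, cover all scoring vectors, carry the correct gain, and are pairwise separated by the
constraints considered so far.  Hence a region of maximum gain consists of optimal scoring vectors
(`PoolInvariant.gain_le`).  It also bounds the number of regions: one point from every region gives
pairwise different sets of satisfied constraints, and by linear dependence such sets, given by
linear forms on `ℝ^d`, shatter no set of more than `d` constraints.  By the Sauer–Shelah lemma their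
number is polynomial in the number of constraints (`card_patterns_le`, `PoolInvariant.length_le`).
-/

namespace PSR

/-! ### Sizes of data -/

namespace Val

/-- The entries of a list; a datum that is not a list is cut off at its last pair. -/
def toList : Val → List Val
  | cons a b => a :: toList b
  | _ => []

@[simp] lemma toList_ofList (L : List Val) : (ofList L).toList = L := by
  induction L with
  | nil => rfl
  | cons a L ih => simp [ofList, toList, ih]

lemma one_le_size (v : Val) : 1 ≤ v.size := by
  cases v <;> simp [size]

lemma size_toInt_le (v : Val) : (int v.toInt).size ≤ v.size := by
  cases v <;> simp [toInt, size]

lemma size_head_le (v : Val) : v.head.size ≤ v.size := by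
  cases v <;> simp [head, size]; omega

lemma size_tail_le (v : Val) : v.tail.size ≤ v.size := by
  cases v <;> simp [tail, size]; omega

/-- Splitting a datum into head and tail enlarges it by a constant only. -/
lemma size_head_add_size_tail_le (v : Val) : v.head.size + v.tail.size ≤ v.size + 1 := by
  cases v <;> simp [head, tail, size]; omega

lemma natSize_add_le (a b : ℕ) : Nat.size (a + b) ≤ max (Nat.size a) (Nat.size b) + 1 := by
  rw [Nat.size_le, pow_succ]
  have ha := (Nat.lt_size_self a).trans_le
    (Nat.pow_le_pow_right two_pos (le_max_left (Nat.size a) (Nat.size b)))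
  have hb := (Nat.lt_size_self b).trans_le
    (Nat.pow_le_pow_right two_pos (le_max_right (Nat.size a) (Nat.size b)))
  omega

lemma natSize_mul_le (a b : ℕ) : Nat.size (a * b) ≤ Nat.size a + Nat.size b := by
  rw [Nat.size_le, pow_add]
  exact Nat.mul_lt_mul'' (Nat.lt_size_self a) (Nat.lt_size_self b)

lemma size_int_add_le (a b : ℤ) : (int (a + b)).size ≤ max (int a).size (int b).size + 1 := by
  have h1 := Nat.size_le_size (Int.natAbs_add_le a b)
  have h2 := natSize_add_le a.natAbs b.natAbs
  simp only [size]; omega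

@[simp] lemma size_int_neg (a : ℤ) : (int (-a)).size = (int a).size := by simp [size]

lemma size_int_mul_le (a b : ℤ) : (int (a * b)).size + 1 ≤ (int a).size + (int b).size := by
  have h2 := natSize_mul_le a.natAbs b.natAbs
  simp only [size, Int.natAbs_mul]; omega

lemma length_toList_le (v : Val) : v.toList.length ≤ v.size := by
  induction v with
  | cons a b _ ih => simp only [toList, List.length_cons, size]; have := one_le_size a; omega
  | _ => simp [toList]

lemma size_le_of_mem_toList {v e : Val} (h : e ∈ v.toList) : e.size ≤ v.size := by
  induction v with
  | cons a b _ ih =>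
    simp only [toList, List.mem_cons] at h
    rcases h with rfl | h
    · simp only [size]; omega
    · have := ih h; simp only [size]; omega
  | _ => simp [toList] at h

/-- The result of a loop is a right fold over the entries of the list. -/
lemma loop_fst (f : Val → Val → Val × ℕ) (init : Val × ℕ) (v : Val) :
    (loop f init v).1 = v.toList.foldr (fun e acc => (f e acc).1) init.1 := by
  induction v with
  | cons a b _ ih => simp [loop, toList, ih]
  | _ => simp [loop, toList]

/-- Invariants of loops: if `I` holds initially and is maintained by an iteration, which moreover
costs at most `B`, then `I` holds at the end, and the loop costs at most `B` per entry. -/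
lemma loop_invariant {f : Val → Val → Val × ℕ} {init : Val × ℕ} {v : Val} {B : ℕ}
    (I : List Val → Val → Prop) (h0 : I [] init.1)
    (h : ∀ e L acc, (e :: L) <:+ v.toList → I L acc →
      I (e :: L) (f e acc).1 ∧ (f e acc).2 + e.size + acc.size + 1 ≤ B) :
    I v.toList (loop f init v).1 ∧ (loop f init v).2 ≤ init.2 + v.toList.length * B := by
  induction v with
  | cons a b _ ih =>
    have hb := ih fun e L acc hs => h e L acc (hs.trans (List.suffix_cons a b.toList))
    have ha := h a b.toList _ (List.suffix_refl _) hb.1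
    refine ⟨ha.1, ?_⟩
    simp only [loop, toList, List.length_cons]
    have := hb.2
    have := ha.2
    rw [add_mul]; omega
  | _ => simpa [loop, toList] using h0

end Val

/-- A polynomial with natural coefficients is monotone. -/
lemma polynomial_eval_mono (q : Polynomial ℕ) {m n : ℕ} (h : m ≤ n) : q.eval m ≤ q.eval n := by
  induction q using Polynomial.induction_on' with
  | add p q hp hq => simpa using add_le_add hp hq
  | monomial k a => simpa using Nat.mul_le_mul_left a (Nat.pow_le_pow_left h k)

namespace Prog

/-! ### A calculus of polynomial running times -/

/-- A result is never larger than the time that it takes to compute it. -/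
lemma size_run_le (p : Prog) (ρ : Env) : (p.run ρ).1.size ≤ (p.run ρ).2 := by
  induction p generalizing ρ with
  | var x => simp [run]
  | lit z => simp [run]
  | nil => simp [run, Val.size]
  | cons p q hp hq => have := hp ρ; have := hq ρ; simp only [run, Val.size]; omega
  | head p hp =>
    have := hp ρ; have := Val.size_head_le (p.run ρ).1; simp only [run]; omega
  | tail p hp =>
    have := hp ρ; have := Val.size_tail_le (p.run ρ).1; simp only [run]; omega
  | add p q hp hq =>
    have := Val.size_int_add_le (p.run ρ).1.toInt (q.run ρ).1.toInt
    have := Val.size_toInt_le (p.run ρ).1; have := Val.size_toInt_le (q.run ρ).1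
    simp only [run]; omega
  | sub p q hp hq =>
    have := Val.size_int_add_le (p.run ρ).1.toInt (-(q.run ρ).1.toInt)
    have := Val.size_toInt_le (p.run ρ).1; have := Val.size_toInt_le (q.run ρ).1
    rw [Val.size_int_neg, ← sub_eq_add_neg] at *
    simp only [run]; omega
  | mul p q hp hq =>
    have := Val.size_int_mul_le (p.run ρ).1.toInt (q.run ρ).1.toInt
    have := Val.size_toInt_le (p.run ρ).1; have := Val.size_toInt_le (q.run ρ).1
    have := Val.one_le_size (p.run ρ).1; have := Val.one_le_size (q.run ρ).1
    have := hp ρ; have := hq ρ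
    simp only [run]; omega
  | ifPos c p q hc hp hq =>
    have := hp ρ; have := hq ρ; simp only [run]; split_ifs <;> omega
  | ifNil c p q hc hp hq =>
    have := hp ρ; have := hq ρ; simp only [run]; split_ifs <;> omega
  | bind x p q hp hq =>
    have := hq (Function.update ρ x (p.run ρ).1); simp only [run]; omega
  | loop x y l init body hl hi hb =>
    simp only [run]
    suffices h : ∀ v, (Val.loop (fun e acc =>
        body.run (Function.update (Function.update ρ x e) y acc)) (init.run ρ) v).1.size ≤
        (Val.loop (fun e acc =>
        body.run (Function.update (Function.update ρ x e) y acc)) (init.run ρ) v).2 by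
      have := h (l.run ρ).1; omega
    intro v
    cases v with
    | cons a b => simp only [Val.loop]; exact (hb _).trans (by omega)
    | _ => exact hi ρ

variable {H H' : Env → Prop} {V W : Set ℕ} {p q c l init body : Prog} {x y : ℕ}

/-- On environments that satisfy `H`, the program `p` runs in time polynomial in the sizes of the
variables in `V`. -/
def PolyTime (H : Env → Prop) (V : Set ℕ) (p : Prog) : Prop :=
  ∃ q : Polynomial ℕ, ∀ (ρ : Env) (n : ℕ), H ρ → (∀ x ∈ V, (ρ x).size ≤ n) →
    (p.run ρ).2 ≤ q.eval n

/-- On environments that satisfy `H`, the result of `p` is larger than the variable `y` by at most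
a polynomial in the sizes of the variables in `V`.  For the body `p` of a loop with accumulator `y`
this prevents exponential growth of the accumulator. -/
def Grows (H : Env → Prop) (V : Set ℕ) (y : ℕ) (p : Prog) : Prop :=
  ∃ q : Polynomial ℕ, ∀ (ρ : Env) (n : ℕ), H ρ → (∀ x ∈ V, (ρ x).size ≤ n) →
    (p.run ρ).1.size ≤ (ρ y).size + q.eval n

lemma PolyTime.mono (h : PolyTime H V p) (hV : V ⊆ W) : PolyTime H W p := by
  obtain ⟨q, hq⟩ := h
  exact ⟨q, fun ρ n hρ hn => hq ρ n hρ fun x hx => hn x (hV hx)⟩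

lemma polyTime_var (hx : x ∈ V) : PolyTime H V (var x) :=
  ⟨.X + 1, fun ρ n _ hn => by simpa [run] using hn x hx⟩

lemma polyTime_lit (z : ℤ) : PolyTime H V (lit z) :=
  ⟨.C ((Val.int z).size + 1), fun ρ n _ _ => by simp [run]⟩

lemma polyTime_nil : PolyTime H V nil :=
  ⟨.C 2, fun ρ n _ _ => by simp [run]⟩

lemma PolyTime.cons (hp : PolyTime H V p) (hq : PolyTime H V q) : PolyTime H V (cons p q) := by
  obtain ⟨a, ha⟩ := hp
  obtain ⟨b, hb⟩ := hq
  refine ⟨2 * a + 2 * b + 1, fun ρ n hρ hn => ?_⟩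
  have := ha ρ n hρ hn; have := hb ρ n hρ hn
  have := size_run_le p ρ; have := size_run_le q ρ
  simp only [run, Polynomial.eval_add, Polynomial.eval_mul, Polynomial.eval_ofNat,
    Polynomial.eval_one]; omega

lemma PolyTime.head (hp : PolyTime H V p) : PolyTime H V (head p) := by
  obtain ⟨a, ha⟩ := hp
  refine ⟨2 * a + 1, fun ρ n hρ hn => ?_⟩
  have := ha ρ n hρ hn; have := size_run_le p ρ
  simp only [run, Polynomial.eval_add, Polynomial.eval_mul, Polynomial.eval_ofNat,
    Polynomial.eval_one]; omega

lemma PolyTime.tail (hp : PolyTime H V p) : PolyTime H V (tail p) := by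
  obtain ⟨a, ha⟩ := hp
  refine ⟨2 * a + 1, fun ρ n hρ hn => ?_⟩
  have := ha ρ n hρ hn; have := size_run_le p ρ
  simp only [run, Polynomial.eval_add, Polynomial.eval_mul, Polynomial.eval_ofNat,
    Polynomial.eval_one]; omega

lemma PolyTime.add (hp : PolyTime H V p) (hq : PolyTime H V q) : PolyTime H V (add p q) := by
  obtain ⟨a, ha⟩ := hp
  obtain ⟨b, hb⟩ := hq
  refine ⟨2 * a + 2 * b + 1, fun ρ n hρ hn => ?_⟩
  have := ha ρ n hρ hn; have := hb ρ n hρ hn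
  have := size_run_le p ρ; have := size_run_le q ρ
  simp only [run, Polynomial.eval_add, Polynomial.eval_mul, Polynomial.eval_ofNat,
    Polynomial.eval_one]; omega

lemma PolyTime.sub (hp : PolyTime H V p) (hq : PolyTime H V q) : PolyTime H V (sub p q) := by
  obtain ⟨a, ha⟩ := hp
  obtain ⟨b, hb⟩ := hq
  refine ⟨2 * a + 2 * b + 1, fun ρ n hρ hn => ?_⟩
  have := ha ρ n hρ hn; have := hb ρ n hρ hn
  have := size_run_le p ρ; have := size_run_le q ρ
  simp only [run, Polynomial.eval_add, Polynomial.eval_mul, Polynomial.eval_ofNat,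
    Polynomial.eval_one]; omega

lemma PolyTime.mul (hp : PolyTime H V p) (hq : PolyTime H V q) : PolyTime H V (mul p q) := by
  obtain ⟨a, ha⟩ := hp
  obtain ⟨b, hb⟩ := hq
  refine ⟨a + b + a * b + 1, fun ρ n hρ hn => ?_⟩
  have h1 := ha ρ n hρ hn; have h2 := hb ρ n hρ hn
  have := Nat.mul_le_mul ((size_run_le p ρ).trans h1) ((size_run_le q ρ).trans h2)
  simp only [run, Polynomial.eval_add, Polynomial.eval_mul, Polynomial.eval_one]; omega

lemma PolyTime.ifPos (hc : PolyTime H V c) (hp : PolyTime H V p) (hq : PolyTime H V q) :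
    PolyTime H V (ifPos c p q) := by
  obtain ⟨k, hk⟩ := hc
  obtain ⟨a, ha⟩ := hp
  obtain ⟨b, hb⟩ := hq
  refine ⟨2 * k + a + b + 1, fun ρ n hρ hn => ?_⟩
  have := hk ρ n hρ hn; have := ha ρ n hρ hn; have := hb ρ n hρ hn
  have := size_run_le c ρ
  simp only [run, Polynomial.eval_add, Polynomial.eval_mul, Polynomial.eval_ofNat,
    Polynomial.eval_one]; split_ifs <;> omega

lemma PolyTime.ifNil (hc : PolyTime H V c) (hp : PolyTime H V p) (hq : PolyTime H V q) :
    PolyTime H V (ifNil c p q) := by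
  obtain ⟨k, hk⟩ := hc
  obtain ⟨a, ha⟩ := hp
  obtain ⟨b, hb⟩ := hq
  refine ⟨2 * k + a + b + 1, fun ρ n hρ hn => ?_⟩
  have := hk ρ n hρ hn; have := ha ρ n hρ hn; have := hb ρ n hρ hn
  have := size_run_le c ρ
  simp only [run, Polynomial.eval_add, Polynomial.eval_mul, Polynomial.eval_ofNat,
    Polynomial.eval_one]; split_ifs <;> omega

lemma size_update_le {ρ : Env} {n : ℕ} {v : Val} (hn : ∀ z ∈ V, (ρ z).size ≤ n)
    (hv : v.size ≤ n) : ∀ z ∈ insert x V, (Function.update ρ x v z).size ≤ n := by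
  intro z hz
  by_cases h : z = x
  · subst h; simpa using hv
  · rw [Function.update_of_ne h]; exact hn z (hz.resolve_left h)

lemma PolyTime.bind (hp : PolyTime H V p) (hq : PolyTime H' (insert x V) q)
    (hH : ∀ ρ, H ρ → H' (Function.update ρ x (p.run ρ).1)) : PolyTime H V (bind x p q) := by
  obtain ⟨a, ha⟩ := hp
  obtain ⟨b, hb⟩ := hq
  refine ⟨2 * a + b.comp (.X + a) + 1, fun ρ n hρ hn => ?_⟩
  have h1 := ha ρ n hρ hn
  have h2 := size_run_le p ρ
  have := hb (Function.update ρ x (p.run ρ).1) (n + a.eval n) (hH ρ hρ)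
    (size_update_le (fun z hz => (hn z hz).trans (by omega)) (by omega))
  simp only [run, Polynomial.eval_add, Polynomial.eval_mul, Polynomial.eval_ofNat,
    Polynomial.eval_one, Polynomial.eval_comp, Polynomial.eval_X]; omega

lemma PolyTime.grows (hp : PolyTime H V p) : Grows H V y p := by
  obtain ⟨a, ha⟩ := hp
  refine ⟨a, fun ρ n hρ hn => ?_⟩
  have := ha ρ n hρ hn; have := size_run_le p ρ; omega

lemma grows_var : Grows H V y (var y) :=
  ⟨0, fun ρ n _ _ => by simp [run]⟩

lemma Grows.cons (hp : PolyTime H V p) (hq : Grows H V y q) : Grows H V y (cons p q) := by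
  obtain ⟨a, ha⟩ := hp
  obtain ⟨b, hb⟩ := hq
  refine ⟨a + b + 1, fun ρ n hρ hn => ?_⟩
  have := ha ρ n hρ hn; have := hb ρ n hρ hn; have := size_run_le p ρ
  simp only [run, Val.size, Polynomial.eval_add, Polynomial.eval_one]; omega

lemma Grows.add (hp : PolyTime H V p) (hq : Grows H V y q) : Grows H V y (add p q) := by
  obtain ⟨a, ha⟩ := hp
  obtain ⟨b, hb⟩ := hq
  refine ⟨a + b + 1, fun ρ n hρ hn => ?_⟩
  have := ha ρ n hρ hn; have := hb ρ n hρ hn; have := size_run_le p ρ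
  have := Val.size_int_add_le (p.run ρ).1.toInt (q.run ρ).1.toInt
  have := Val.size_toInt_le (p.run ρ).1; have := Val.size_toInt_le (q.run ρ).1
  simp only [run, Polynomial.eval_add, Polynomial.eval_one]; omega

lemma Grows.ifPos (hp : Grows H V y p) (hq : Grows H V y q) : Grows H V y (ifPos c p q) := by
  obtain ⟨a, ha⟩ := hp
  obtain ⟨b, hb⟩ := hq
  refine ⟨a + b, fun ρ n hρ hn => ?_⟩
  have := ha ρ n hρ hn; have := hb ρ n hρ hn
  simp only [run, Polynomial.eval_add]; split_ifs <;> omega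

lemma Grows.ifNil (hp : Grows H V y p) (hq : Grows H V y q) : Grows H V y (ifNil c p q) := by
  obtain ⟨a, ha⟩ := hp
  obtain ⟨b, hb⟩ := hq
  refine ⟨a + b, fun ρ n hρ hn => ?_⟩
  have := ha ρ n hρ hn; have := hb ρ n hρ hn
  simp only [run, Polynomial.eval_add]; split_ifs <;> omega

lemma Grows.bind (hp : PolyTime H V p) (hq : Grows H' (insert x V) y q) (hxy : y ≠ x)
    (hH : ∀ ρ, H ρ → H' (Function.update ρ x (p.run ρ).1)) : Grows H V y (bind x p q) := by
  obtain ⟨a, ha⟩ := hp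
  obtain ⟨b, hb⟩ := hq
  refine ⟨b.comp (.X + a), fun ρ n hρ hn => ?_⟩
  have h1 := ha ρ n hρ hn
  have h2 := size_run_le p ρ
  have := hb (Function.update ρ x (p.run ρ).1) (n + a.eval n) (hH ρ hρ)
    (size_update_le (fun z hz => (hn z hz).trans (by omega)) (by omega))
  rw [Function.update_of_ne hxy] at this
  simpa [run] using this

/-- The environment in which the body of a loop is run. -/
abbrev loopEnv (ρ : Env) (x y : ℕ) (e acc : Val) : Env :=
  Function.update (Function.update ρ x e) y acc

/-- If `H` holds before a loop over `l`, then `H'` holds whenever its body is run. -/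
def LoopPre (H H' : Env → Prop) (x y : ℕ) (l : Prog) : Prop :=
  ∀ ρ, H ρ → ∀ e ∈ (l.run ρ).1.toList, ∀ acc, H' (loopEnv ρ x y e acc)

lemma length_toList_le_run (l : Prog) (ρ : Env) : (l.run ρ).1.toList.length ≤ (l.run ρ).2 :=
  (Val.length_toList_le _).trans (size_run_le l ρ)

lemma size_mem_toList_le_run {l : Prog} {ρ : Env} {e : Val} (he : e ∈ (l.run ρ).1.toList) :
    e.size ≤ (l.run ρ).2 :=
  (Val.size_le_of_mem_toList he).trans (size_run_le l ρ)

/-- In a loop whose accumulator grows by at most `G` per iteration, the accumulator stays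
bounded by its initial size plus `G` times the number of iterations. -/
lemma size_loop_le {f : Val → Val → Val × ℕ} {init : Val × ℕ} {v : Val} {G B : ℕ}
    (hf : ∀ e ∈ v.toList, ∀ acc, (f e acc).1.size ≤ acc.size + G)
    (hB : ∀ e ∈ v.toList, ∀ acc, acc.size ≤ init.1.size + v.toList.length * G →
      (f e acc).2 + e.size + acc.size + 1 ≤ B) :
    (Val.loop f init v).1.size ≤ init.1.size + v.toList.length * G ∧
      (Val.loop f init v).2 ≤ init.2 + v.toList.length * B := by
  refine Val.loop_invariant (fun L acc => acc.size ≤ init.1.size + L.length * G) (by simp) ?_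
  intro e L acc hs hacc
  have he : e ∈ v.toList := hs.subset (by simp)
  have hlen : L.length * G + G ≤ v.toList.length * G := by
    have := Nat.mul_le_mul_right G hs.length_le
    rwa [List.length_cons, add_mul, one_mul] at this
  refine ⟨?_, hB e he acc (by omega)⟩
  have := hf e he acc
  rw [List.length_cons, add_mul, one_mul]; omega

/-- Loops whose accumulators grow slowly run in polynomial time. -/
lemma PolyTime.loop (hl : PolyTime H V l) (hi : PolyTime H V init)
    (hb : PolyTime H' (insert y (insert x V)) body) (hg : Grows H' (insert x V) y body)
    (hxy : x ≠ y) (hy : y ∉ V) (hH : LoopPre H H' x y l) :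
    PolyTime H V (Prog.loop x y l init body) := by
  obtain ⟨a, ha⟩ := hl
  obtain ⟨i, hi⟩ := hi
  obtain ⟨b, hb⟩ := hb
  obtain ⟨g, hg⟩ := hg
  -- The sizes of the entries are bounded by `X + a`, those of the accumulators by `A`.
  let G : Polynomial ℕ := g.comp (.X + a)
  let A : Polynomial ℕ := i + a * G
  let B : Polynomial ℕ := b.comp (.X + a + A) + a + A + 1
  refine ⟨2 * a + 2 * i + a * B + 1, fun ρ n hρ hn => ?_⟩
  have h1 := ha ρ n hρ hn
  have h2 := hi ρ n hρ hn
  have h3 := size_run_le l ρ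
  have h4 := size_run_le init ρ
  have hlen := length_toList_le_run l ρ
  have hA : (init.run ρ).1.size + (l.run ρ).1.toList.length * G.eval n ≤ A.eval n := by
    have := Nat.mul_le_mul_right (G.eval n) (hlen.trans h1)
    simp only [A, Polynomial.eval_add, Polynomial.eval_mul]; omega
  have key := size_loop_le (f := fun e acc => body.run (loopEnv ρ x y e acc))
    (init := init.run ρ) (v := (l.run ρ).1) (G := G.eval n) (B := B.eval n) ?_ ?_
  · have := Nat.mul_le_mul_right (B.eval n) (hlen.trans h1)
    have := key.2
    simp only [run, loopEnv, Polynomial.eval_add, Polynomial.eval_mul, Polynomial.eval_ofNat,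
      Polynomial.eval_one] at *
    omega
  · intro e he acc
    have h5 := size_mem_toList_le_run he
    have := hg (loopEnv ρ x y e acc) (n + a.eval n) (hH ρ hρ e he acc) (by
      intro z hz
      have hzy : z ≠ y := by
        rintro rfl
        exact hz.elim (fun h => hxy h.symm) hy
      rw [loopEnv, Function.update_of_ne hzy]
      exact size_update_le (fun z hz => (hn z hz).trans (by omega)) (by omega) z hz)
    simpa [G, loopEnv] using this
  · intro e he acc hacc
    have h5 := size_mem_toList_le_run he
    have := hb (loopEnv ρ x y e acc) (n + a.eval n + A.eval n) (hH ρ hρ e he acc)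
      (size_update_le (size_update_le (fun z hz => (hn z hz).trans (by omega)) (by omega))
        (by omega))
    simp only [B, Polynomial.eval_add, Polynomial.eval_comp, Polynomial.eval_X,
      Polynomial.eval_one]
    omega

/-- The case of an inner loop, started in the accumulator `y` of an outer loop. -/
lemma Grows.loop {z : ℕ} (hl : PolyTime H V l) (hi : Grows H V y init)
    (hg : Grows H' (insert x V) z body)
    (hxz : x ≠ z) (hz : z ∉ V) (hH : LoopPre H H' x z l) :
    Grows H V y (Prog.loop x z l init body) := by
  obtain ⟨a, ha⟩ := hl
  obtain ⟨i, hi⟩ := hi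
  obtain ⟨g, hg⟩ := hg
  refine ⟨i + a * g.comp (.X + a), fun ρ n hρ hn => ?_⟩
  have h1 := ha ρ n hρ hn
  have h2 := hi ρ n hρ hn
  have hlen := length_toList_le_run l ρ
  have h3 := Nat.mul_le_mul_right (g.eval (n + a.eval n)) (hlen.trans h1)
  have key : ∀ L : List Val, (∀ e ∈ L, e ∈ (l.run ρ).1.toList) →
      (L.foldr (fun e acc => (body.run (loopEnv ρ x z e acc)).1) (init.run ρ).1).size ≤
        (init.run ρ).1.size + L.length * g.eval (n + a.eval n) := by
    intro L
    induction L with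
    | nil => simp
    | cons e L ih =>
      intro hL
      have he := hL e (by simp)
      have h5 := size_mem_toList_le_run he
      have h6 := ih fun e he => hL e (by simp [he])
      have := hg (loopEnv ρ x z e (L.foldr (fun e acc => (body.run (loopEnv ρ x z e acc)).1)
        (init.run ρ).1)) (n + a.eval n) (hH ρ hρ e he _) (by
          intro u hu
          have huz : u ≠ z := by
            rintro rfl
            exact hu.elim (fun h => hxz h.symm) hz
          rw [loopEnv, Function.update_of_ne huz]
          exact size_update_le (fun z hz => (hn z hz).trans (by omega)) (by omega) u hu)
      rw [loopEnv, Function.update_self] at this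
      rw [List.foldr_cons, List.length_cons, add_mul, one_mul]
      simp only [loopEnv] at *
      omega
  have := key _ fun e he => he
  simp only [run, loopEnv, Val.loop_fst, Polynomial.eval_add, Polynomial.eval_mul,
    Polynomial.eval_comp, Polynomial.eval_X] at *
  omega

/-- Loops with a bounded number `k` of iterations run in polynomial time. -/
lemma PolyTime.loop_of_length_le (k : ℕ) (hl : PolyTime H V l) (hi : PolyTime H V init)
    (hb : PolyTime H' (insert y (insert x V)) body) (hH : LoopPre H H' x y l)
    (hk : ∀ ρ, H ρ → (l.run ρ).1.toList.length ≤ k) :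
    PolyTime H V (Prog.loop x y l init body) := by
  obtain ⟨a, ha⟩ := hl
  obtain ⟨i, hi⟩ := hi
  obtain ⟨b, hb⟩ := hb
  -- `A j` bounds the size of the accumulator after `j` iterations.
  let A : ℕ → Polynomial ℕ := fun j => Nat.rec i (fun _ A => A + b.comp (.X + a + A)) j
  have hA : ∀ n, Monotone fun j => (A j).eval n := fun n =>
    monotone_nat_of_le_succ fun j => by simp [A]
  let B : Polynomial ℕ := b.comp (.X + a + A k) + a + A k + 1
  refine ⟨2 * a + 2 * i + a * B + 1, fun ρ n hρ hn => ?_⟩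
  have h1 := ha ρ n hρ hn
  have h2 := hi ρ n hρ hn
  have h3 := size_run_le l ρ
  have h4 := size_run_le init ρ
  have hlen := length_toList_le_run l ρ
  have key := Val.loop_invariant (f := fun e acc => body.run (loopEnv ρ x y e acc))
    (init := init.run ρ) (v := (l.run ρ).1) (B := B.eval n)
    (fun L acc => acc.size ≤ (A L.length).eval n) (h4.trans h2) ?_
  · have := Nat.mul_le_mul_right (B.eval n) (hlen.trans h1)
    have := key.2
    simp only [run, loopEnv, Polynomial.eval_add, Polynomial.eval_mul, Polynomial.eval_ofNat,
      Polynomial.eval_one] at *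
    omega
  · intro e L acc hs hacc
    have he : e ∈ (l.run ρ).1.toList := hs.subset (by simp)
    have h5 := size_mem_toList_le_run he
    have hLk : L.length ≤ k := by
      have := hs.length_le
      have := hk ρ hρ
      simp only [List.length_cons] at *; omega
    have h6 := hA n hLk
    simp only at h6
    have h7 := hb (loopEnv ρ x y e acc) (n + a.eval n + (A L.length).eval n) (hH ρ hρ e he acc)
      (size_update_le (size_update_le (fun z hz => (hn z hz).trans (by omega)) (by omega))
        (by omega))
    have h8 := polynomial_eval_mono b (add_le_add_right h6 (n + a.eval n))
    have h9 := size_run_le body (loopEnv ρ x y e acc)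
    constructor
    · have : (A (L.length + 1)).eval n =
          (A L.length).eval n + b.eval (n + a.eval n + (A L.length).eval n) := by simp [A]
      rw [List.length_cons, this]
      omega
    · simp only [B, Polynomial.eval_add, Polynomial.eval_comp, Polynomial.eval_X,
        Polynomial.eval_one]
      omega

end Prog

end PSR

namespace PSR

/-! ### Fourier–Motzkin elimination and back-substitution -/

/-- A homogeneous linear inequality given by a list of coefficients; it is strict if the first
component is positive.  Unlike the length of an `Ineq`, the number of variables may vary. -/
abbrev Row := ℤ × List ℤ

namespace Row

/-- The coefficient of the first variable (`0` if there are no variables). -/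
def lead (r : Row) : ℤ := r.2.headD 0

/-- The coefficients of the other variables. -/
def rest (r : Row) : List ℤ := r.2.tail

variable {R : Type*} [CommRing R]

/-- The value of an integer linear form at a point. -/
def dot (u : List ℤ) (s : List R) : R := (List.zipWith (fun (a : ℤ) x => (a : R) * x) u s).sum

@[simp] lemma dot_nil (s : List R) : dot [] s = 0 := by simp [dot]

@[simp] lemma dot_nil_right (u : List ℤ) : dot u ([] : List R) = 0 := by simp [dot]

@[simp] lemma dot_cons (a : ℤ) (u : List ℤ) (x : R) (s : List R) :
    dot (a :: u) (x :: s) = a * x + dot u s := by simp [dot]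

lemma dot_eq_lead_add (r : Row) (x : R) (s : List R) :
    dot r.2 (x :: s) = r.lead * x + dot r.rest s := by
  obtain ⟨f, _ | ⟨a, u⟩⟩ := r <;> simp [lead, rest]

lemma dot_zipWith (α β : ℤ) (u v : List ℤ) (h : u.length = v.length) (s : List R) :
    dot (List.zipWith (fun a b => α * a + β * b) u v) s = α * dot u s + β * dot v s := by
  induction u generalizing v s with
  | nil => cases v <;> simp_all
  | cons a u ih =>
    cases v with
    | nil => simp at h
    | cons b v =>
      cases s with
      | nil => simp
      | cons x s =>
        rw [List.zipWith_cons_cons, dot_cons, dot_cons, dot_cons, ih v (by simpa using h)]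
        push_cast; ring

lemma dot_map_mul (m : R) (u : List ℤ) (s : List R) :
    dot u (s.map (m * ·)) = m * dot u s := by
  induction u generalizing s with
  | nil => simp
  | cons a u ih =>
    cases s with
    | nil => simp
    | cons x s => rw [List.map_cons, dot_cons, dot_cons, ih]; ring

/-- The point `s` satisfies the inequality `r`.  The weak inequality is always part of it, so that
strict and weak inequalities can be combined without a case distinction. -/
def Sat [LinearOrder R] (r : Row) (s : List R) : Prop :=
  0 ≤ dot r.2 s ∧ (0 < r.1 → 0 < dot r.2 s)

/-- The positive combination of two inequalities in which the first variable cancels; meant for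
inequalities with a positive and a negative leading coefficient, respectively. -/
def comb (r r' : Row) : Row :=
  (if 0 < r.1 then 1 else r'.1,
    List.zipWith (fun a b => (0 - r'.lead) * a + r.lead * b) r.rest r'.rest)

lemma dot_comb {r r' : Row} (h : r.rest.length = r'.rest.length) (s : List R) :
    dot (comb r r').2 s = -r'.lead * dot r.rest s + r.lead * dot r'.rest s := by
  rw [comb, dot_zipWith _ _ _ _ h]; push_cast; ring

lemma comb_strict_iff (r r' : Row) : 0 < (comb r r').1 ↔ 0 < r.1 ∨ 0 < r'.1 := by
  simp only [comb]; split_ifs with h <;> simp [h]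

end Row

open Row

/-- One step of Fourier–Motzkin elimination: all combinations that cancel the first variable, and
the inequalities in which it does not occur.  The shape of the definition is that of the program. -/
def elim (S : List Row) : List Row :=
  S.foldr (fun r acc =>
    if 0 < r.lead then
      S.foldr (fun r' acc' => if 0 < 0 - r'.lead then comb r r' :: acc' else acc') acc
    else if 0 < 0 - r.lead then acc else (r.1, r.rest) :: acc) []

lemma mem_elim {S : List Row} {r : Row} : r ∈ elim S ↔
    (∃ r₁ ∈ S, ∃ r₂ ∈ S, 0 < r₁.lead ∧ r₂.lead < 0 ∧ r = comb r₁ r₂) ∨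
      ∃ r₀ ∈ S, r₀.lead = 0 ∧ r = (r₀.1, r₀.rest) := by
  have inner : ∀ (r₁ : Row) (T acc : List Row),
      r ∈ T.foldr (fun r' acc' => if 0 < 0 - r'.lead then comb r₁ r' :: acc' else acc') acc ↔
        (∃ r₂ ∈ T, r₂.lead < 0 ∧ r = comb r₁ r₂) ∨ r ∈ acc := by
    intro r₁ T acc
    induction T with
    | nil => simp
    | cons t T ih =>
      rw [List.foldr_cons]
      split_ifs with h
      · rw [List.mem_cons, ih, List.exists_mem_cons_iff]
        have : t.lead < 0 := by omega
        simp only [this, true_and, or_assoc]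
      · rw [ih, List.exists_mem_cons_iff]
        have : ¬ t.lead < 0 := by omega
        simp only [this, false_and, false_or]
  suffices h : ∀ T : List Row, r ∈ T.foldr (fun r acc =>
      if 0 < r.lead then
        S.foldr (fun r' acc' => if 0 < 0 - r'.lead then comb r r' :: acc' else acc') acc
      else if 0 < 0 - r.lead then acc else (r.1, r.rest) :: acc) [] ↔
      (∃ r₁ ∈ T, ∃ r₂ ∈ S, 0 < r₁.lead ∧ r₂.lead < 0 ∧ r = comb r₁ r₂) ∨
        ∃ r₀ ∈ T, r₀.lead = 0 ∧ r = (r₀.1, r₀.rest) from h S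
  intro T
  induction T with
  | nil => simp
  | cons t T ih =>
    rw [List.foldr_cons, List.exists_mem_cons_iff, List.exists_mem_cons_iff]
    split_ifs with h h'
    · rw [inner, ih]
      have : ¬ t.lead = 0 := by omega
      simp only [h, this, true_and, false_and, false_or, or_assoc]
    · rw [ih]
      have h1 : ¬ t.lead = 0 := by omega
      simp [h, h1]
    · rw [List.mem_cons, ih]
      have h1 : t.lead = 0 := by omega
      simp only [h1, lt_irrefl, false_and, and_false, exists_false, false_or, true_and]
      rw [or_left_comm]

/-- All rows of the system have `k` coefficients. -/
def HasWidth (k : ℕ) (S : List Row) : Prop := ∀ r ∈ S, r.2.length = k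

lemma HasWidth.length_rest {k : ℕ} {S : List Row} (h : HasWidth (k + 1) S) {r : Row} (hr : r ∈ S) :
    r.rest.length = k := by
  simp [Row.rest, h r hr]

lemma HasWidth.elim {k : ℕ} {S : List Row} (h : HasWidth (k + 1) S) : HasWidth k (elim S) := by
  intro r hr
  rcases mem_elim.1 hr with ⟨r₁, h₁, r₂, h₂, -, -, rfl⟩ | ⟨r₀, h₀, -, rfl⟩
  · simp [comb, h.length_rest h₁, h.length_rest h₂]
  · exact h.length_rest h₀

/-- Elimination is a projection: solutions of a system restrict to solutions of the
eliminated system. -/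
lemma sat_elim {R : Type*} [CommRing R] [LinearOrder R] [IsStrictOrderedRing R] {k : ℕ}
    {S : List Row} (hS : HasWidth (k + 1) S) {x : R} {s : List R} (hs : ∀ r ∈ S, r.Sat (x :: s)) :
    ∀ r ∈ elim S, r.Sat s := by
  intro r hr
  rcases mem_elim.1 hr with ⟨r₁, h₁, r₂, h₂, hp, hn, rfl⟩ | ⟨r₀, h₀, hz, rfl⟩
  · have e := dot_comb ((hS.length_rest h₁).trans (hS.length_rest h₂).symm) s
    have s₁ := hs r₁ h₁
    have s₂ := hs r₂ h₂
    have hp' : (0 : R) < r₁.lead := by exact_mod_cast hp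
    have hn' : (0 : R) < -r₂.lead := by
      have : (r₂.lead : R) < 0 := by exact_mod_cast hn
      linarith
    have e' : dot (comb r₁ r₂).2 s =
        -r₂.lead * dot r₁.2 (x :: s) + r₁.lead * dot r₂.2 (x :: s) := by
      rw [e, dot_eq_lead_add, dot_eq_lead_add]; ring
    have n₁ := mul_nonneg hn'.le s₁.1
    have n₂ := mul_nonneg hp'.le s₂.1
    refine ⟨by rw [e']; linarith, fun hst => ?_⟩
    rw [e']
    rcases (comb_strict_iff r₁ r₂).1 hst with h | h
    · have := mul_pos hn' (s₁.2 h); linarith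
    · have := mul_pos hp' (s₂.2 h); linarith
  · have := hs r₀ h₀
    simpa [Sat, dot_eq_lead_add, hz] using this

/-- The extreme ray `(p, q)` in the half-plane `q ≥ 0` among the boundary rays of the inequalities
`a p + q D ≥ 0` with `σ a > 0`, where `a` is the leading coefficient and `D` the value of the other
terms at `t`.  For `σ = 1` it is the greatest lower bound `p / q` for the first variable, for
`σ = -1` the least upper bound, and the ray `(-σ, 0)` stands for the bound `∓∞`. -/
def extreme (σ : ℤ) (S : List Row) (t : List ℤ) : ℤ × ℤ :=
  S.foldr (fun r acc =>
    if 0 < σ * r.lead then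
      if 0 < 0 - (r.lead * acc.1 + acc.2 * dot r.rest t) then
        ((0 - σ) * dot r.rest t, σ * r.lead)
      else acc
    else acc) (0 - σ, 0)

/-- The extreme ray is a boundary ray of one of the inequalities or the default one, and it
satisfies all the inequalities. -/
lemma extreme_spec (σ : ℤ) (S : List Row) (t : List ℤ) :
    (extreme σ S t = (-σ, 0) ∨
      ∃ r ∈ S, 0 < σ * r.lead ∧ extreme σ S t = (-σ * dot r.rest t, σ * r.lead)) ∧
    ∀ r ∈ S, 0 < σ * r.lead →
      0 ≤ r.lead * (extreme σ S t).1 + (extreme σ S t).2 * dot r.rest t := by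
  induction S with
  | nil => simp [extreme]
  | cons r₀ S ih =>
    obtain ⟨ih1, ih2⟩ := ih
    have hcons : extreme σ (r₀ :: S) t = if 0 < σ * r₀.lead then
      if 0 < 0 - (r₀.lead * (extreme σ S t).1 + (extreme σ S t).2 * dot r₀.rest t) then
        ((0 - σ) * dot r₀.rest t, σ * r₀.lead) else extreme σ S t else extreme σ S t := rfl
    have hold : ∀ E, E = extreme σ S t → (E = (-σ, 0) ∨
        ∃ r ∈ r₀ :: S, 0 < σ * r.lead ∧ E = (-σ * dot r.rest t, σ * r.lead)) := by
      rintro E rfl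
      rcases ih1 with h | ⟨r, hr, h⟩
      · exact Or.inl h
      · exact Or.inr ⟨r, List.mem_cons_of_mem _ hr, h⟩
    rw [hcons]
    split_ifs with h1 h2
    · -- The old ray violates `r₀` and is replaced by the boundary ray of `r₀`.  For `σ = 1`, the
      -- bound given by `r₀` exceeds the old one, which is at least the bound given by any other `r`.
      refine ⟨Or.inr ⟨r₀, by simp, h1, by simp⟩, ?_⟩
      intro r hr hpos
      rcases List.mem_cons.1 hr with rfl | hr
      · simp only; nlinarith
      · have h3 := ih2 r hr hpos
        simp only
        rcases ih1 with h | ⟨r', hr', hpos', h⟩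
        · -- the default ray satisfies no inequality with `σ a > 0`
          rw [h] at h3; simp only at h3; nlinarith
        · rw [h] at h2 h3
          simp only at h2 h3
          generalize dot r.rest t = D at *
          generalize dot r₀.rest t = D₀ at *
          generalize dot r'.rest t = D' at *
          generalize r.lead = a at *
          generalize r₀.lead = a₀ at *
          generalize r'.lead = a' at *
          have key : 0 ≤ (σ * a') * (a * ((0 - σ) * D₀) + σ * a₀ * D) := by
            have e : (σ * a') * (a * ((0 - σ) * D₀) + σ * a₀ * D) =
              (σ * a₀) * (a * (-σ * D') + σ * a' * D) +
                (σ * a) * (0 - (a₀ * (-σ * D') + σ * a' * D₀)) := by ring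
            rw [e]
            exact add_nonneg (mul_nonneg h1.le h3) (mul_nonneg hpos.le h2.le)
          exact nonneg_of_mul_nonneg_right key hpos'
    · refine ⟨hold _ rfl, ?_⟩
      intro r hr hpos
      rcases List.mem_cons.1 hr with rfl | hr
      · omega
      · exact ih2 r hr hpos
    · refine ⟨hold _ rfl, ?_⟩
      intro r hr hpos
      rcases List.mem_cons.1 hr with rfl | hr
      · exact absurd hpos h1
      · exact ih2 r hr hpos

/-- Back-substitution: a solution of the eliminated system is scaled and extended by a value for the
first variable.  In homogeneous coordinates, the sum of the extreme rays lies strictly between the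
greatest lower and the least upper bound unless these coincide. -/
def extend (S : List Row) (t : List ℤ) : List ℤ :=
  let L := extreme 1 S t
  let U := extreme (-1) S t
  if 0 < L.2 + U.2 then (L.1 + U.1) :: t.map ((L.2 + U.2) * ·) else 0 :: t

lemma sat_extend {k : ℕ} {S : List Row} (hS : HasWidth (k + 1) S) {t : List ℤ}
    (ht : ∀ r ∈ elim S, r.Sat t) : ∀ r ∈ S, r.Sat (extend S t) := by
  obtain ⟨hL, hL'⟩ := extreme_spec 1 S t
  obtain ⟨hU, hU'⟩ := extreme_spec (-1) S t
  -- the inequalities without the first variable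
  have hzero : ∀ r ∈ S, r.lead = 0 → 0 ≤ dot r.rest t ∧ (0 < r.1 → 0 < dot r.rest t) :=
    fun r hr h => ht _ (mem_elim.2 (Or.inr ⟨r, hr, h, rfl⟩))
  -- the combinations of inequalities with leading coefficients of opposite signs
  have hcomb : ∀ r ∈ S, ∀ r' ∈ S, 0 < r.lead → r'.lead < 0 →
      0 ≤ -r'.lead * dot r.rest t + r.lead * dot r'.rest t ∧
      (0 < r.1 ∨ 0 < r'.1 → 0 < -r'.lead * dot r.rest t + r.lead * dot r'.rest t) := by
    intro r hr r' hr' h h'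
    have := ht _ (mem_elim.2 (Or.inl ⟨r, hr, r', hr', h, h', rfl⟩))
    rwa [Sat, dot_comb ((hS.length_rest hr).trans (hS.length_rest hr').symm),
      comb_strict_iff, Int.cast_id, Int.cast_id] at this
  intro r hr
  -- the contribution of the opposite extreme ray
  have hUpos : 0 < r.lead →
      0 ≤ r.lead * (extreme (-1) S t).1 + (extreme (-1) S t).2 * dot r.rest t ∧
      (0 < r.1 → 0 < r.lead * (extreme (-1) S t).1 + (extreme (-1) S t).2 * dot r.rest t) := by
    intro h
    rcases hU with e | ⟨r', hr', h', e⟩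
    · rw [e]; simp only; constructor <;> intros <;> linarith
    · rw [e]
      have := hcomb r hr r' hr' h (by linarith)
      have e' : r.lead * (- -1 * dot r'.rest t) + -1 * r'.lead * dot r.rest t =
        -r'.lead * dot r.rest t + r.lead * dot r'.rest t := by ring
      simp only
      rw [e']
      exact ⟨this.1, fun hs => this.2 (Or.inl hs)⟩
  have hLneg : r.lead < 0 →
      0 ≤ r.lead * (extreme 1 S t).1 + (extreme 1 S t).2 * dot r.rest t ∧
      (0 < r.1 → 0 < r.lead * (extreme 1 S t).1 + (extreme 1 S t).2 * dot r.rest t) := by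
    intro h
    rcases hL with e | ⟨r', hr', h', e⟩
    · rw [e]; simp only; constructor <;> intros <;> linarith
    · rw [e]
      have := hcomb r' hr' r hr (by linarith) h
      have e' : r.lead * (-1 * dot r'.rest t) + 1 * r'.lead * dot r.rest t =
        -r.lead * dot r'.rest t + r'.lead * dot r.rest t := by ring
      simp only
      rw [e']
      exact ⟨this.1, fun hs => this.2 (Or.inr hs)⟩
  have hL0 : 0 ≤ (extreme 1 S t).2 := by
    rcases hL with e | ⟨r', hr', h', e⟩ <;> rw [e]
    exact h'.le
  have hU0 : 0 ≤ (extreme (-1) S t).2 := by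
    rcases hU with e | ⟨r', hr', h', e⟩ <;> rw [e]
    exact h'.le
  simp only [extend]
  split_ifs with hpos
  · rw [Sat, dot_eq_lead_add, dot_map_mul, Int.cast_id]
    generalize extreme 1 S t = L at *
    generalize extreme (-1) S t = U at *
    have e : r.lead * (L.1 + U.1) + (L.2 + U.2) * dot r.rest t =
      (r.lead * L.1 + L.2 * dot r.rest t) + (r.lead * U.1 + U.2 * dot r.rest t) := by ring
    rw [e]
    rcases lt_trichotomy r.lead 0 with h | h | h
    · have h1 := hLneg h
      have h2 := hU' r hr (by linarith)
      exact ⟨by linarith, fun hs => by linarith [h1.2 hs]⟩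
    · have h1 := hzero r hr h
      rw [← e, h, zero_mul, zero_add]
      exact ⟨mul_nonneg hpos.le h1.1, fun hs => mul_pos hpos (h1.2 hs)⟩
    · have h1 := hUpos h
      have h2 := hL' r hr (by linarith)
      exact ⟨by linarith, fun hs => by linarith [h1.2 hs]⟩
  · -- both rays are default ones, so that the first variable does not occur
    have eL : extreme 1 S t = (-1, 0) := by
      rcases hL with e | ⟨r', hr', h', e⟩
      · exact e
      · rw [e] at hpos; simp only at hpos; omega
    have eU : extreme (-1) S t = (- -1, 0) := by
      rcases hU with e | ⟨r', hr', h', e⟩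
      · exact e
      · rw [e] at hpos; simp only at hpos; omega
    have h : r.lead = 0 := by
      rcases lt_trichotomy r.lead 0 with h | h | h
      · have h2 := hU' r hr (by linarith)
        rw [eU] at h2; simp only at h2; omega
      · exact h
      · have h2 := hL' r hr (by linarith)
        rw [eL] at h2; simp only at h2; omega
    have := hzero r hr h
    simpa [Sat, dot_eq_lead_add, h] using this

@[simp] lemma length_extend (S : List Row) (t : List ℤ) : (extend S t).length = t.length + 1 := by
  simp only [extend]; split_ifs <;> simp

/-- The systems that arise from `S` by eliminating `k, k - 1, …, 0` variables. -/
def stack (S : List Row) : ℕ → List (List Row)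
  | 0 => [S]
  | k + 1 => elim ((stack S k).headD []) :: stack S k

lemma headD_stack (S : List Row) (k : ℕ) : (stack S k).headD [] = elim^[k] S := by
  induction k with
  | zero => rfl
  | succ k ih => rw [stack, List.headD_cons, ih, Function.iterate_succ_apply']

/-- One step of the back-substitution: pop a system from the stack and extend the solution. -/
def backStep (st : List (List Row) × List ℤ) : List (List Row) × List ℤ :=
  (st.1.tail, extend (st.1.headD []) st.2)

/-- The full back-substitution after the elimination of `k` variables. -/
def backSolve (S : List Row) (k : ℕ) : List ℤ :=
  (backStep^[k] ((stack S k).tail, [])).2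

lemma HasWidth.iterate_elim {S : List Row} {k : ℕ} (hS : HasWidth k S) :
    ∀ {j m : ℕ}, j + m = k → HasWidth m (PSR.elim^[j] S) := by
  intro j
  induction j with
  | zero => rintro m rfl; simpa using hS
  | succ j ih =>
    rintro m rfl
    rw [Function.iterate_succ_apply']
    exact (ih (by omega)).elim

/-- If no strict inequality `0 > 0` is left after the elimination of all `k` variables, then the
back-substitution yields a solution. -/
lemma sat_backSolve {S : List Row} {k : ℕ} (hS : HasWidth k S)
    (h : ∀ r ∈ elim^[k] S, ¬ 0 < r.1) :
    (∀ r ∈ S, r.Sat (backSolve S k)) ∧ (backSolve S k).length = k := by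
  have key : ∀ j m, j + m = k →
      (backStep^[j] ((stack S k).tail, [])).1 = (stack S m).tail ∧
      (backStep^[j] ((stack S k).tail, [])).2.length = j ∧
      ∀ r ∈ elim^[m] S, r.Sat (backStep^[j] ((stack S k).tail, [])).2 := by
    intro j
    induction j with
    | zero =>
      rintro m hm
      obtain rfl : m = k := by omega
      refine ⟨rfl, rfl, fun r hr => ?_⟩
      simp [Sat, h r hr]
    | succ j ih =>
      intro m hm
      obtain ⟨h1, h2, h3⟩ := ih (m + 1) (by omega)
      rw [Function.iterate_succ_apply', backStep, h1, stack, List.tail_cons]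
      refine ⟨rfl, by simp [h2], ?_⟩
      rw [Function.iterate_succ_apply'] at h3
      rw [headD_stack]
      exact sat_extend (hS.iterate_elim (j := m) (m := j + 1) (by omega)) h3
  obtain ⟨-, h2, h3⟩ := key k 0 rfl
  exact ⟨h3, h2⟩

/-- If the system has a solution, then no strict inequality `0 > 0` is left after the elimination
of all variables. -/
lemma not_strict_of_sat {R : Type*} [CommRing R] [LinearOrder R] [IsStrictOrderedRing R] {k : ℕ}
    {S : List Row} (hS : HasWidth k S) {s : List R} (hlen : s.length = k)
    (hs : ∀ r ∈ S, r.Sat s) : ∀ r ∈ elim^[k] S, ¬ 0 < r.1 := by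
  induction k generalizing S s with
  | zero =>
    intro r hr hpos
    obtain rfl := List.length_eq_zero_iff.1 hlen
    have := (hs r hr).2 hpos
    simp at this
  | succ k ih =>
    obtain ⟨x, s, rfl⟩ := List.exists_cons_of_length_eq_add_one hlen
    rw [Function.iterate_succ_apply]
    exact ih hS.elim (by simpa using hlen) (sat_elim hS hs)

end PSR

namespace PSR

/-! ### Programs for vectors -/

/-!
Programs that are used inside others have local variables with larger numbers, from 60 for `rev`
down to 20 for the main program `fourierMotzkin`, so that they do not overwrite the variables of the
programs that use them.  This is the purpose of hypotheses such as `∀ x ∈ V, x < 60`.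
-/

namespace Val

/-- The datum that represents a list of integers. -/
def ints (u : List ℤ) : Val := ofList (u.map int)

@[simp] lemma head_cons (a b : Val) : (cons a b).head = a := rfl

@[simp] lemma tail_cons (a b : Val) : (cons a b).tail = b := rfl

@[simp] lemma toInt_int (z : ℤ) : (int z).toInt = z := rfl

@[simp] lemma toInt_head_ints (u : List ℤ) : (ints u).head.toInt = u.headD 0 := by
  cases u <;> simp [ints, ofList, head, toInt]

@[simp] lemma tail_ints (u : List ℤ) : (ints u).tail = ints u.tail := by
  cases u <;> simp [ints, ofList, tail]

@[simp] lemma toList_ints (u : List ℤ) : (ints u).toList = u.map int := by simp [ints]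

lemma cons_int_ints (z : ℤ) (u : List ℤ) : cons (int z) (ints u) = ints (z :: u) := rfl

lemma nil_eq_ints : nil = ints [] := rfl

end Val

namespace Prog

section Results

variable (p q c l init body : Prog) (x y : ℕ) (z : ℤ) (ρ : Env)

@[simp] lemma run_var_fst : ((var x).run ρ).1 = ρ x := rfl

@[simp] lemma run_lit_fst : ((lit z).run ρ).1 = .int z := rfl

@[simp] lemma run_nil_fst : (nil.run ρ).1 = .nil := rfl

@[simp] lemma run_cons_fst : ((cons p q).run ρ).1 = .cons (p.run ρ).1 (q.run ρ).1 := rfl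

@[simp] lemma run_head_fst : ((head p).run ρ).1 = (p.run ρ).1.head := rfl

@[simp] lemma run_tail_fst : ((tail p).run ρ).1 = (p.run ρ).1.tail := rfl

@[simp] lemma run_add_fst :
    ((add p q).run ρ).1 = .int ((p.run ρ).1.toInt + (q.run ρ).1.toInt) := rfl

@[simp] lemma run_sub_fst :
    ((sub p q).run ρ).1 = .int ((p.run ρ).1.toInt - (q.run ρ).1.toInt) := rfl

@[simp] lemma run_mul_fst :
    ((mul p q).run ρ).1 = .int ((p.run ρ).1.toInt * (q.run ρ).1.toInt) := rfl

@[simp] lemma run_ifPos_fst : ((ifPos c p q).run ρ).1 =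
    if 0 < (c.run ρ).1.toInt then (p.run ρ).1 else (q.run ρ).1 := by
  simp only [run]; split_ifs <;> rfl

@[simp] lemma run_ifNil_fst : ((ifNil c p q).run ρ).1 =
    if (c.run ρ).1.isNil then (p.run ρ).1 else (q.run ρ).1 := by
  simp only [run]; split_ifs <;> rfl

@[simp] lemma run_bind_fst :
    ((bind x p q).run ρ).1 = (q.run (Function.update ρ x (p.run ρ).1)).1 := rfl

@[simp] lemma run_loop_fst : ((loop x y l init body).run ρ).1 =
    (l.run ρ).1.toList.foldr (fun e acc => (body.run (loopEnv ρ x y e acc)).1)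
      (init.run ρ).1 := by
  simp only [run, Val.loop_fst]

end Results

variable {H : Env → Prop} {V : Set ℕ} {p q : Prog} {ρ : Env}

/-- Reversal of a list: the accumulator holds the entries that are still to be moved and the
entries that have been moved; the entry of the loop serves as a counter only. -/
def rev (p : Prog) : Prog :=
  tail (loop 60 61 p (cons p nil)
    (cons (tail (head (var 61))) (cons (head (head (var 61))) (tail (var 61)))))

lemma run_rev {L : List Val} (h : (p.run ρ).1 = Val.ofList L) :
    ((rev p).run ρ).1 = Val.ofList L.reverse := by
  let g : Val → Val := fun acc => .cons acc.head.tail (.cons acc.head.head acc.tail)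
  have key : ∀ A B : List Val, g^[A.length] (.cons (Val.ofList A) (Val.ofList B)) =
      .cons .nil (Val.ofList (A.reverse ++ B)) := by
    intro A
    induction A with
    | nil => intro B; rfl
    | cons a A ih =>
      intro B
      rw [List.length_cons, Function.iterate_succ_apply]
      have := ih (a :: B)
      simpa [g, Val.ofList, Val.head, Val.tail] using this
  have h1 : ((rev p).run ρ).1 =
      (L.foldr (fun _ => g) (.cons (Val.ofList L) (Val.ofList []))).tail := by
    simp [rev, h, g, Val.ofList]
  rw [h1, List.foldr_const, key]
  simp [Val.tail]

lemma polyTime_rev (hp : PolyTime H V p) (hV : ∀ x ∈ V, x < 60) : PolyTime H V (rev p) := by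
  have h61 : PolyTime (fun _ => True) (insert 61 (insert 60 V)) (var 61) := polyTime_var (by simp)
  refine (PolyTime.loop (H' := fun _ => True) hp (hp.cons polyTime_nil)
    (h61.head.tail.cons (h61.head.head.cons h61.tail)) ⟨4, fun ρ n _ _ => ?_⟩ (by simp)
    (fun h => absurd (hV _ h) (by simp)) (fun _ _ _ _ _ => trivial)).tail
  -- An iteration only moves an entry inside the accumulator.
  have h1 := Val.size_head_add_size_tail_le (ρ 61)
  have h2 := Val.size_head_add_size_tail_le (ρ 61).head
  simp only [run, Val.size, Polynomial.eval_ofNat]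
  omega

/-- The list of pairs of corresponding entries of two lists of the same length.  As loops start at
the end of a list, the entries of the second list are taken from its reversal. -/
def zip (p q : Prog) : Prog :=
  tail (loop 50 51 p (cons (rev q) nil)
    (cons (tail (head (var 51))) (cons (cons (var 50) (head (head (var 51)))) (tail (var 51)))))

lemma run_zip {L M : List Val} (hp : (p.run ρ).1 = Val.ofList L) (hq : (q.run ρ).1 = Val.ofList M)
    (hlen : L.length = M.length) :
    ((zip p q).run ρ).1 = Val.ofList (List.zipWith Val.cons L M) := by
  let g : Val → Val → Val := fun e acc =>
    .cons acc.head.tail (.cons (.cons e acc.head.head) acc.tail)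
  -- `T` are the entries that the loop has not reached when `A` and `B` have been processed.
  have key : ∀ A B T : List Val, A.length = B.length →
      A.foldr g (.cons (Val.ofList (B.reverse ++ T)) .nil) =
        .cons (Val.ofList T) (Val.ofList (List.zipWith Val.cons A B)) := by
    intro A
    induction A with
    | nil => intro B T h; cases B <;> simp_all [Val.ofList]
    | cons a A ih =>
      intro B T h
      cases B with
      | nil => simp at h
      | cons b B =>
        have := ih B (b :: T) (by simpa using h)
        rw [List.foldr_cons, List.reverse_cons, List.append_assoc, List.singleton_append, this]
        rfl
  have h1 : ((zip p q).run ρ).1 =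
      (L.foldr g (.cons (Val.ofList (M.reverse ++ [])) .nil)).tail := by
    simp [zip, hp, run_rev hq, g]
  rw [h1, key L M [] hlen]
  simp [Val.tail]

lemma polyTime_zip (hp : PolyTime H V p) (hq : PolyTime H V q) (hV : ∀ x ∈ V, x < 50) :
    PolyTime H V (zip p q) := by
  have h50 : PolyTime (fun _ => True) (insert 51 (insert 50 V)) (var 50) := polyTime_var (by simp)
  have h51 : PolyTime (fun _ => True) (insert 51 (insert 50 V)) (var 51) := polyTime_var (by simp)
  have hr := polyTime_rev hq fun x hx => (hV x hx).trans (by simp)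
  refine (PolyTime.loop (H' := fun _ => True) hp (hr.cons polyTime_nil)
    (h51.head.tail.cons ((h50.cons h51.head.head).cons h51.tail))
    ⟨.X + 5, fun ρ n _ hn => ?_⟩ (by simp)
    (fun h => absurd (hV _ h) (by simp)) (fun _ _ _ _ _ => trivial)).tail
  have h0 := hn 50 (by simp)
  have h1 := Val.size_head_add_size_tail_le (ρ 51)
  have h2 := Val.size_head_add_size_tail_le (ρ 51).head
  simp only [run, Val.size, Polynomial.eval_add, Polynomial.eval_X, Polynomial.eval_ofNat]
  omega

/-- The scalar product of two integer vectors. -/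
def dot (p q : Prog) : Prog :=
  loop 40 41 (zip p q) (lit 0) (add (mul (head (var 40)) (tail (var 40))) (var 41))

lemma run_dot {u v : List ℤ} (hp : (p.run ρ).1 = Val.ints u) (hq : (q.run ρ).1 = Val.ints v)
    (hlen : u.length = v.length) : ((dot p q).run ρ).1 = .int (Row.dot u v) := by
  have key : ∀ u v : List ℤ, (List.zipWith Val.cons (u.map .int) (v.map .int)).foldr
      (fun e acc => .int (e.head.toInt * e.tail.toInt + acc.toInt)) (.int 0) =
        Val.int (Row.dot u v) := by
    intro u
    induction u with
    | nil => simp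
    | cons a u ih =>
      intro v
      cases v with
      | nil => simp
      | cons b v =>
        have := ih v
        simp only [List.map_cons, List.zipWith_cons_cons, List.foldr_cons, this, Val.head_cons,
          Val.tail_cons, Val.toInt_int, Row.dot_cons, Int.cast_id]
  rw [dot, run_loop_fst, run_zip hp hq (by simpa using hlen), ← key]
  simp

lemma polyTime_dot (hp : PolyTime H V p) (hq : PolyTime H V q) (hV : ∀ x ∈ V, x < 40) :
    PolyTime H V (dot p q) := by
  have h40 : ∀ W : Set ℕ, PolyTime (fun _ => True) (insert 40 W) (var 40) :=
    fun W => polyTime_var (by simp)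
  have hm := (h40 V).head.mul (h40 V).tail
  exact PolyTime.loop (H' := fun _ => True)
    (polyTime_zip hp hq fun x hx => (hV x hx).trans (by simp)) (polyTime_lit 0)
    ((hm.mono (Set.subset_insert _ _)).add (polyTime_var (by simp)))
    (Grows.add hm grows_var) (by simp)
    (fun h => absurd (hV _ h) (by simp)) (fun _ _ _ _ _ => trivial)

/-- The linear combination of two integer vectors; the factors must not depend on the variables
of the loop. -/
def lincomb (α β p q : Prog) : Prog :=
  loop 40 41 (zip p q) nil
    (cons (add (mul α (head (var 40))) (mul β (tail (var 40)))) (var 41))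

lemma run_lincomb {α β : Prog} {a b : ℤ} {u v : List ℤ} (hp : (p.run ρ).1 = Val.ints u)
    (hq : (q.run ρ).1 = Val.ints v) (hlen : u.length = v.length)
    (hα : ∀ e acc, (α.run (loopEnv ρ 40 41 e acc)).1.toInt = a)
    (hβ : ∀ e acc, (β.run (loopEnv ρ 40 41 e acc)).1.toInt = b) :
    ((lincomb α β p q).run ρ).1 = Val.ints (List.zipWith (fun x y => a * x + b * y) u v) := by
  have key : ∀ u v : List ℤ, (List.zipWith Val.cons (u.map .int) (v.map .int)).foldr
      (fun e acc => Val.cons (.int (a * e.head.toInt + b * e.tail.toInt)) acc) .nil =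
        Val.ints (List.zipWith (fun x y => a * x + b * y) u v) := by
    intro u
    induction u with
    | nil => simp [Val.nil_eq_ints]
    | cons x u ih =>
      intro v
      cases v with
      | nil => simp [Val.nil_eq_ints]
      | cons y v =>
        have := ih v
        simp only [List.map_cons, List.zipWith_cons_cons, List.foldr_cons, this, Val.head_cons,
          Val.tail_cons, Val.toInt_int, Val.cons_int_ints]
  rw [lincomb, run_loop_fst, run_zip hp hq (by simpa using hlen), ← key]
  simp only [run_cons_fst, run_add_fst, run_mul_fst, hα, hβ]
  simp

lemma polyTime_lincomb {α β : Prog} (hα : PolyTime (fun _ => True) V α)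
    (hβ : PolyTime (fun _ => True) V β) (hp : PolyTime H V p) (hq : PolyTime H V q)
    (hV : ∀ x ∈ V, x < 40) : PolyTime H V (lincomb α β p q) := by
  have h40 : ∀ W : Set ℕ, PolyTime (fun _ => True) (insert 40 W) (var 40) :=
    fun W => polyTime_var (by simp)
  have hm := ((hα.mono (Set.subset_insert _ _)).mul (h40 V).head).add
    ((hβ.mono (Set.subset_insert _ _)).mul (h40 V).tail)
  exact PolyTime.loop (H' := fun _ => True)
    (polyTime_zip hp hq fun x hx => (hV x hx).trans (by simp)) polyTime_nil
    ((hm.mono (Set.subset_insert _ _)).cons (polyTime_var (by simp)))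
    (Grows.cons hm grows_var) (by simp)
    (fun h => absurd (hV _ h) (by simp)) (fun _ _ _ _ _ => trivial)

/-! ### A linear programming subroutine -/

/-- An inequality, with the representation of `encSystem`. -/
def _root_.PSR.encRow (r : Row) : Val := .cons (.int r.1) (Val.ints r.2)

/-- A system of inequalities, with the representation of `encSystem`. -/
def _root_.PSR.encRows (S : List Row) : Val := Val.ofList (S.map encRow)

@[simp] lemma toInt_head_encRow (r : Row) : (encRow r).head.toInt = r.1 := rfl

@[simp] lemma tail_encRow (r : Row) : (encRow r).tail = Val.ints r.2 := rfl

lemma foldr_map_encode {α β : Type*} {enc : α → Val} {enc' : β → Val} {f : Val → Val → Val}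
    {g : α → β → β} {L : List α} {b : β}
    (h : ∀ e ∈ L, ∀ acc, f (enc e) (enc' acc) = enc' (g e acc)) :
    (L.map enc).foldr f (enc' b) = enc' (L.foldr g b) := by
  induction L with
  | nil => rfl
  | cons e L ih =>
    rw [List.map_cons, List.foldr_cons, List.foldr_cons,
      ih fun e he => h e (List.mem_cons_of_mem _ he), h e (by simp)]

/-- The combination `Row.comb` of the inequalities in the variables 31 and 33. -/
def combRows : Prog :=
  cons (ifPos (head (var 31)) (lit 1) (head (var 33)))
    (lincomb (sub (lit 0) (head (tail (var 33)))) (head (tail (var 31)))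
      (tail (tail (var 31))) (tail (tail (var 33))))

lemma run_combRows {r r' : Row} (h : ρ 31 = encRow r) (h' : ρ 33 = encRow r')
    (hlen : r.rest.length = r'.rest.length) : (combRows.run ρ).1 = encRow (r.comb r') := by
  have h1 := run_lincomb (ρ := ρ) (p := tail (tail (var 31))) (q := tail (tail (var 33)))
    (α := sub (lit 0) (head (tail (var 33)))) (β := head (tail (var 31)))
    (a := 0 - r'.lead) (b := r.lead) (u := r.rest) (v := r'.rest)
    (by simp [h, Row.rest]) (by simp [h', Row.rest]) hlen
    (fun e acc => by simp [h', Row.lead]) (fun e acc => by simp [h, Row.lead])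
  rw [combRows, run_cons_fst, h1]
  simp only [encRow, Row.comb]
  congr 1
  simp only [run_ifPos_fst, run_head_fst, run_var_fst, run_lit_fst, h, h', toInt_head_encRow]
  split_ifs <;> rfl

lemma polyTime_combRows (h : 31 ∈ V) (h' : 33 ∈ V) (hV : ∀ x ∈ V, x < 40) :
    PolyTime H V combRows := by
  have h1 : ∀ H, PolyTime H V (var 31) := fun H => polyTime_var h
  have h2 : ∀ H, PolyTime H V (var 33) := fun H => polyTime_var h'
  exact ((h1 _).head.ifPos (polyTime_lit 1) (h2 _).head).cons
    (polyTime_lincomb ((polyTime_lit 0).sub (h2 _).tail.head) (h1 _).tail.head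
      (h1 _).tail.tail (h2 _).tail.tail hV)

/-- The program for `PSR.elim`. -/
def elim (p : Prog) : Prog :=
  bind 30 p
    (loop 31 32 (var 30) nil
      (ifPos (head (tail (var 31)))
        (loop 33 34 (var 30) (var 32)
          (ifPos (sub (lit 0) (head (tail (var 33)))) (cons combRows (var 34)) (var 34)))
        (ifPos (sub (lit 0) (head (tail (var 31)))) (var 32)
          (cons (cons (head (var 31)) (tail (tail (var 31)))) (var 32)))))

lemma run_elim {S : List Row} {k : ℕ} (hS : HasWidth k S) (h : (p.run ρ).1 = encRows S) :
    ((elim p).run ρ).1 = encRows (PSR.elim S) := by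
  have hlead : ∀ r, (encRow r).tail.head.toInt = r.lead := fun r => by simp [Row.lead]
  simp only [elim, run_bind_fst, run_loop_fst, run_var_fst, run_nil_fst, h, Function.update_self,
    PSR.elim]
  rw [encRows, Val.toList_ofList]
  refine foldr_map_encode (enc' := encRows) (b := []) fun r hr acc => ?_
  have inner : (S.map encRow).foldr (fun e acc' =>
      ((ifPos (sub (lit 0) (head (tail (var 33)))) (cons combRows (var 34)) (var 34)).run
        (loopEnv (loopEnv (Function.update ρ 30 (encRows S)) 31 32 (encRow r) (encRows acc))
          33 34 e acc')).1) (encRows acc) =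
      encRows (S.foldr (fun r' acc' => if 0 < 0 - r'.lead then r.comb r' :: acc' else acc') acc) :=
    foldr_map_encode fun r' hr' acc' => by
      have hc := run_combRows (ρ := loopEnv (loopEnv (Function.update ρ 30 (encRows S)) 31 32
        (encRow r) (encRows acc)) 33 34 (encRow r') (encRows acc')) (r := r) (r' := r')
        (by simp) (by simp) (by simp [Row.rest, hS r hr, hS r' hr'])
      rw [run_ifPos_fst, run_cons_fst, hc]
      simp [-tail_encRow, hlead]
      split_ifs <;> rfl
  rw [run_ifPos_fst, run_loop_fst]
  have e1 : ((var 30).run (loopEnv (Function.update ρ 30 (Val.ofList (S.map encRow))) 31 32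
      (encRow r) (encRows acc))).1.toList = S.map encRow := by simp
  have e2 : ((var 32).run (loopEnv (Function.update ρ 30 (Val.ofList (S.map encRow))) 31 32
      (encRow r) (encRows acc))).1 = encRows acc := by simp
  rw [e1, e2]
  rw [encRows] at inner
  rw [inner]
  simp only [run_head_fst, run_tail_fst, run_var_fst, run_ifPos_fst, run_sub_fst, run_lit_fst,
    run_cons_fst, ne_eq, Nat.reduceEqDiff, not_false_eq_true, Function.update_of_ne,
    Function.update_self, hlead, Val.toInt_int]
  split_ifs
  · rfl
  · rfl
  · simp [encRows, encRow, Row.rest, Val.ofList, Val.head]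

lemma polyTime_elim (hp : PolyTime H V p) (hV : ∀ x ∈ V, x < 30) : PolyTime H V (elim p) := by
  have h1 : ∀ {H : Env → Prop} (W : Set ℕ), PolyTime H (insert 31 W) (var 31) :=
    fun W => polyTime_var (by simp)
  have hcomb : ∀ {H : Env → Prop}, PolyTime H (insert 33 (insert 31 (insert 30 V))) combRows := by
    intro H
    refine polyTime_combRows (by simp) (by simp) ?_
    intro x hx
    simp only [Set.mem_insert_iff] at hx
    rcases hx with rfl | rfl | rfl | hx <;> first | simp | exact (hV x hx).trans (by simp)
  have hrow : ∀ {H : Env → Prop} (W : Set ℕ), PolyTime H (insert 31 W)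
      (cons (head (var 31)) (tail (tail (var 31)))) :=
    fun W => (h1 W).head.cons (h1 W).tail.tail
  have h32 : ∀ W : Set ℕ, insert 31 W ⊆ insert 32 (insert 31 W) := fun W => Set.subset_insert _ _
  have hn : ∀ m, 30 ≤ m → m ∉ V := fun m hm h => absurd (hV m h) (by omega)
  refine PolyTime.bind (H' := fun _ => True) hp ?_ fun _ _ => trivial
  refine PolyTime.loop (H' := fun _ => True) (polyTime_var (by simp)) polyTime_nil ?_ ?_
    (by simp) (by simp [hn]) fun _ _ _ _ _ => trivial
  · refine (h1 _).tail.head.mono (h32 _) |>.ifPos ?_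
      (((polyTime_lit 0).sub ((h1 _).tail.head.mono (h32 _))).ifPos (polyTime_var (by simp))
        (((hrow _).mono (h32 _)).cons (polyTime_var (by simp))))
    refine PolyTime.loop (H' := fun _ => True) (polyTime_var (by simp)) (polyTime_var (by simp))
      ?_ ?_ (by simp) (by simp [hn]) fun _ _ _ _ _ => trivial
    · refine ((polyTime_lit 0).sub (PolyTime.head (PolyTime.tail (polyTime_var ?_)))).ifPos
        ((hcomb.mono ?_).cons (polyTime_var ?_)) (polyTime_var ?_)
      · simp
      · intro x; simp only [Set.mem_insert_iff]; tauto
      · simp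
      · simp
    · refine Grows.ifPos (Grows.cons (hcomb.mono ?_) grows_var) grows_var
      intro x; simp only [Set.mem_insert_iff]; tauto
  · refine Grows.ifPos ?_ (Grows.ifPos grows_var (Grows.cons (hrow _) grows_var))
    exact Grows.loop (H' := fun _ => True) (polyTime_var (by simp)) grows_var
      (Grows.ifPos (Grows.cons hcomb grows_var) grows_var) (by simp) (by simp [hn])
      fun _ _ _ _ _ => trivial

end Prog

end PSR

namespace PSR

namespace Prog

variable {H : Env → Prop} {V : Set ℕ} {p q : Prog} {ρ : Env}

lemma toInt_head_tail_encRow (r : Row) : (encRow r).tail.head.toInt = r.lead := by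
  simp [Row.lead]

lemma tail_tail_encRow (r : Row) : (encRow r).tail.tail = Val.ints r.rest := by
  simp [Row.rest]

/-- The representation of a ray in homogeneous coordinates. -/
def _root_.PSR.encRay (e : ℤ × ℤ) : Val := .cons (.int e.1) (.int e.2)

/-- The program for `PSR.extreme`, for the system in the variable 30 and the point in the
variable 31. -/
def extreme (σ : ℤ) : Prog :=
  loop 32 33 (var 30) (cons (sub (lit 0) (lit σ)) (lit 0))
    (bind 34 (dot (tail (tail (var 32))) (var 31))
      (ifPos (mul (lit σ) (head (tail (var 32))))
        (ifPos (sub (lit 0) (add (mul (head (tail (var 32))) (head (var 33)))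
            (mul (tail (var 33)) (var 34))))
          (cons (mul (sub (lit 0) (lit σ)) (var 34)) (mul (lit σ) (head (tail (var 32)))))
          (var 33))
        (var 33)))

lemma run_extreme {S : List Row} {t : List ℤ} (σ : ℤ) (hS : HasWidth (t.length + 1) S)
    (h30 : ρ 30 = encRows S) (h31 : ρ 31 = Val.ints t) :
    ((extreme σ).run ρ).1 = encRay (PSR.extreme σ S t) := by
  rw [extreme, run_loop_fst, run_var_fst, h30, encRows, Val.toList_ofList]
  have h0 : ((cons (sub (lit 0) (lit σ)) (lit 0)).run ρ).1 = encRay (0 - σ, 0) := rfl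
  rw [h0, PSR.extreme]
  refine foldr_map_encode fun r hr acc => ?_
  have hd := run_dot (ρ := loopEnv ρ 32 33 (encRow r) (encRay acc))
    (p := tail (tail (var 32))) (q := var 31) (u := r.rest) (v := t)
    (by simp [-tail_encRow, tail_tail_encRow]) (by simp [h31]) (hS.length_rest hr)
  rw [run_bind_fst, hd]
  simp only [run_head_fst, run_tail_fst, run_var_fst, run_ifPos_fst, run_sub_fst, run_lit_fst,
    run_cons_fst, run_mul_fst, run_add_fst, ne_eq, Nat.reduceEqDiff, not_false_eq_true,
    Function.update_of_ne, Function.update_self, toInt_head_tail_encRow, Val.toInt_int]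
  split_ifs <;> first | rfl | contradiction

lemma polyTime_extreme (σ : ℤ) (h30 : 30 ∈ V) (h31 : 31 ∈ V) (hV : ∀ x ∈ V, x < 40)
    (h33 : 33 ∉ V) : PolyTime H V (extreme σ) := by
  have hV' : ∀ x ∈ insert 33 (insert 32 V), x < 40 := by
    intro x hx
    simp only [Set.mem_insert_iff] at hx
    rcases hx with rfl | rfl | hx <;> first | simp | exact hV x hx
  have e : ∀ {H : Env → Prop} (W : Set ℕ), PolyTime H (insert 34 (insert 32 W))
      (cons (mul (sub (lit 0) (lit σ)) (var 34)) (mul (lit σ) (head (tail (var 32))))) :=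
    fun W => (((polyTime_lit 0).sub (polyTime_lit σ)).mul (polyTime_var (by simp))).cons
      ((polyTime_lit σ).mul (PolyTime.head (PolyTime.tail (polyTime_var (by simp)))))
  have hd : ∀ {H : Env → Prop}, PolyTime H (insert 32 V) (dot (tail (tail (var 32))) (var 31)) :=
    polyTime_dot (PolyTime.tail (PolyTime.tail (polyTime_var (by simp))))
      (polyTime_var (by simp [h31])) fun x hx => hV' x (Set.mem_insert_of_mem _ hx)
  refine PolyTime.loop (H' := fun _ => True) (polyTime_var h30)
    (((polyTime_lit 0).sub (polyTime_lit σ)).cons (polyTime_lit 0)) ?_ ?_ (by simp) h33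
    fun _ _ _ _ _ => trivial
  · refine PolyTime.bind (H' := fun _ => True) (hd.mono (Set.subset_insert _ _)) ?_
      fun _ _ => trivial
    have h33' : ∀ {H : Env → Prop}, PolyTime H (insert 34 (insert 33 (insert 32 V))) (var 33) :=
      polyTime_var (by simp)
    have h32' : ∀ {H : Env → Prop}, PolyTime H (insert 34 (insert 33 (insert 32 V))) (var 32) :=
      polyTime_var (by simp)
    refine ((polyTime_lit σ).mul h32'.tail.head).ifPos (((polyTime_lit 0).sub
      ((h32'.tail.head.mul h33'.head).add (h33'.tail.mul (polyTime_var (by simp))))).ifPos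
        ((e V).mono ?_) h33') h33'
    intro x; simp only [Set.mem_insert_iff]; tauto
  · exact Grows.bind (H' := fun _ => True) hd
      (Grows.ifPos (Grows.ifPos (e V).grows grows_var) grows_var) (by simp) fun _ _ => trivial

/-- The program for `PSR.extend`. -/
def extend (p q : Prog) : Prog :=
  bind 30 p (bind 31 q (bind 35 (extreme 1) (bind 36 (extreme (-1))
    (ifPos (add (tail (var 35)) (tail (var 36)))
      (cons (add (head (var 35)) (head (var 36)))
        (loop 37 38 (var 31) nil
          (cons (mul (add (tail (var 35)) (tail (var 36))) (var 37)) (var 38))))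
      (cons (lit 0) (var 31))))))

lemma run_extend {S : List Row} {t : List ℤ} (hS : HasWidth (t.length + 1) S)
    (hp : (p.run ρ).1 = encRows S) (hq : ∀ v, (q.run (Function.update ρ 30 v)).1 = Val.ints t) :
    ((extend p q).run ρ).1 = Val.ints (PSR.extend S t) := by
  simp only [extend, run_bind_fst, hp, hq]
  rw [run_extreme 1 hS (by simp) (by simp)]
  rw [run_extreme (-1) hS (by simp) (by simp)]
  have key : ∀ (m : ℤ) (t : List ℤ), (t.map Val.int).foldr
      (fun e acc => Val.cons (.int (m * e.toInt)) acc) .nil = Val.ints (t.map (m * ·)) := by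
    intro m t
    induction t with
    | nil => rfl
    | cons a t ih => rw [List.map_cons, List.foldr_cons, ih]; rfl
  simp only [run_head_fst, run_tail_fst, run_var_fst, run_ifPos_fst, run_lit_fst, run_nil_fst,
    run_cons_fst, run_mul_fst, run_add_fst, run_loop_fst, ne_eq, Nat.reduceEqDiff,
    not_false_eq_true, Function.update_of_ne, Function.update_self, Val.toInt_int, encRay,
    Val.head_cons, Val.tail_cons, Val.toList_ints, key, PSR.extend]
  split_ifs <;> rfl

lemma polyTime_extend (hp : PolyTime H V p) (hq : PolyTime (fun _ => True) (insert 30 V) q)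
    (hV : ∀ x ∈ V, x < 30) : PolyTime H V (extend p q) := by
  have hn : ∀ m, 30 ≤ m → m ∉ V := fun m hm h => absurd (hV m h) (by omega)
  have hm : ∀ {H : Env → Prop} (W : Set ℕ), PolyTime H (insert 36 (insert 35 W))
      (add (tail (var 35)) (tail (var 36))) :=
    fun W => (polyTime_var (by simp)).tail.add (polyTime_var (by simp)).tail
  have he : ∀ {H : Env → Prop} (W : Set ℕ), PolyTime H (insert 37 (insert 36 (insert 35 W)))
      (mul (add (tail (var 35)) (tail (var 36))) (var 37)) :=
    fun W => ((hm W).mono (Set.subset_insert _ _)).mul (polyTime_var (by simp))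
  refine PolyTime.bind (H' := fun _ => True) hp ?_ fun _ _ => trivial
  refine PolyTime.bind (H' := fun _ => True) hq ?_ fun _ _ => trivial
  refine PolyTime.bind (H' := fun _ => True) (polyTime_extreme 1 (by simp) (by simp) ?_
    (by simp [hn])) ?_ fun _ _ => trivial
  · intro x hx
    simp only [Set.mem_insert_iff] at hx
    rcases hx with rfl | rfl | hx <;> first | simp | exact (hV x hx).trans (by simp)
  refine PolyTime.bind (H' := fun _ => True) (polyTime_extreme (-1) (by simp) (by simp) ?_
    (by simp [hn])) ?_ fun _ _ => trivial
  · intro x hx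
    simp only [Set.mem_insert_iff] at hx
    rcases hx with rfl | rfl | rfl | hx <;> first | simp | exact (hV x hx).trans (by simp)
  refine (hm _).ifPos (((polyTime_var (by simp)).head.add (polyTime_var (by simp)).head).cons
    ?_) ((polyTime_lit 0).cons (polyTime_var (by simp)))
  exact PolyTime.loop (H' := fun _ => True) (polyTime_var (by simp)) polyTime_nil
    (((he _).mono (Set.subset_insert _ _)).cons (polyTime_var (by simp)))
    (Grows.cons (he _) grows_var) (by simp) (by simp [hn]) fun _ _ _ _ _ => trivial

/-- The representation of a stack of systems. -/
def _root_.PSR.encStack (L : List (List Row)) : Val := Val.ofList (L.map encRows)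

lemma head_encStack (L : List (List Row)) : (encStack L).head = encRows (L.headD []) := by
  cases L <;> rfl

lemma tail_encStack (L : List (List Row)) : (encStack L).tail = encStack L.tail := by
  cases L <;> rfl

/-- The stack of the systems that arise by successive elimination of all variables. -/
def buildStack : Prog :=
  loop 23 20 (var vPos) (cons (var vSys) nil) (cons (elim (head (var 20))) (var 20))

/-- The list with one entry for every strict inequality in the system `p`. -/
def strictRows (p : Prog) : Prog :=
  loop 23 20 p nil (ifPos (head (var 23)) (cons nil (var 20)) (var 20))

/-- Back-substitution through the stack in the variable 21. -/
def backSolve : Prog :=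
  tail (loop 23 22 (var vPos) (cons (tail (var 21)) nil)
    (cons (tail (head (var 22))) (extend (head (head (var 22))) (tail (var 22)))))

/-- Fourier–Motzkin elimination. -/
def fourierMotzkin : Prog :=
  bind 21 buildStack
    (ifNil (strictRows (head (var 21)))
      (loop 23 22 backSolve nil (cons (cons (var 23) (lit 1)) (var 22)))
      nil)

lemma run_buildStack {S : List Row} {d : ℕ} (hS : HasWidth d S) (hs : ρ vSys = encRows S)
    (hd : ρ vPos = encPositions d) : (buildStack.run ρ).1 = encStack (stack S d) := by
  have key : ∀ L : List Val, L.length ≤ d → L.foldr (fun e acc =>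
      ((cons (elim (head (var 20))) (var 20)).run (loopEnv ρ 23 20 e acc)).1)
      (.cons (encRows S) .nil) = encStack (stack S L.length) := by
    intro L
    induction L with
    | nil => intro _; rfl
    | cons e L ih =>
      intro hL
      rw [List.length_cons] at hL
      rw [List.foldr_cons, ih (by omega), run_cons_fst, run_elim (S := PSR.elim^[L.length] S)
        (hS.iterate_elim (j := L.length) (m := d - L.length) (by omega))
        (by simp [head_encStack, -List.headD_eq_head?_getD, headD_stack])]
      simp only [List.length_cons, stack, headD_stack]
      simp [encStack, Val.ofList]
  have := key (ρ vPos).toList (by simp [hd, encPositions, encInts])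
  rw [buildStack, run_loop_fst, run_var_fst, run_cons_fst, run_var_fst, hs, run_nil_fst, this]
  simp [hd, encPositions, encInts]

lemma isNil_strictRows {S : List Row} (hp : (p.run ρ).1 = encRows S) :
    ((strictRows p).run ρ).1.isNil = true ↔ ∀ r ∈ S, ¬ 0 < r.1 := by
  rw [strictRows, run_loop_fst, hp, encRows, Val.toList_ofList]
  clear hp
  induction S with
  | nil => simp [Val.isNil]
  | cons r S ih =>
    rw [List.map_cons, List.foldr_cons, List.forall_mem_cons, run_ifPos_fst]
    simp only [run_head_fst, run_var_fst, run_cons_fst, ne_eq, Nat.reduceEqDiff,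
      not_false_eq_true, Function.update_of_ne, Function.update_self, toInt_head_encRow]
    split_ifs with h
    · simp [h, Val.isNil]
    · simp only [h, not_false_eq_true, true_and]
      exact ih

lemma run_backSolve {S : List Row} {d : ℕ} (hS : HasWidth d S) (h21 : ρ 21 = encStack (stack S d))
    (hd : ρ vPos = encPositions d) : (backSolve.run ρ).1 = Val.ints (PSR.backSolve S d) := by
  let enc : List (List Row) × List ℤ → Val := fun st => .cons (encStack st.1) (Val.ints st.2)
  have hst : ∀ j ≤ d, (backStep^[j] ((stack S d).tail, [])).1 = (stack S (d - j)).tail ∧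
      (backStep^[j] ((stack S d).tail, [])).2.length = j := by
    intro j
    induction j with
    | zero => intro _; exact ⟨rfl, rfl⟩
    | succ j ih =>
      intro hj
      obtain ⟨h1, h2⟩ := ih (by omega)
      obtain ⟨m, hm⟩ : ∃ m, d - j = m + 1 := ⟨d - j - 1, by omega⟩
      obtain rfl : m = d - (j + 1) := by omega
      rw [Function.iterate_succ_apply', backStep, h1, hm]
      exact ⟨rfl, by simp [h2]⟩
  have key : ∀ L : List Val, L.length ≤ d → L.foldr (fun e acc =>
      ((cons (tail (head (var 22))) (extend (head (head (var 22))) (tail (var 22)))).run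
        (loopEnv ρ 23 22 e acc)).1) (enc ((stack S d).tail, [])) =
          enc (backStep^[L.length] ((stack S d).tail, [])) := by
    intro L
    induction L with
    | nil => intro _; rfl
    | cons e L ih =>
      intro hL
      rw [List.length_cons] at hL
      rw [List.foldr_cons, ih (by omega), List.length_cons, Function.iterate_succ_apply']
      obtain ⟨h1, h2⟩ := hst L.length (by omega)
      obtain ⟨m, hm⟩ : ∃ m, d - L.length = m + 1 := ⟨d - L.length - 1, by omega⟩
      generalize backStep^[L.length] ((stack S d).tail, []) = st at *
      have hw : HasWidth (st.2.length + 1) (st.1.headD []) := by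
        rw [h1, hm, stack, List.tail_cons, headD_stack]
        exact hS.iterate_elim (by omega)
      rw [run_cons_fst, run_extend hw (by simp [enc, head_encStack]) (by simp [enc])]
      simp [enc, backStep, tail_encStack]
  have := key (ρ vPos).toList (by simp [hd, encPositions, encInts])
  rw [backSolve, run_tail_fst, run_loop_fst, run_var_fst, run_cons_fst, run_tail_fst, run_var_fst,
    h21, run_nil_fst, tail_encStack]
  simp only [enc, Val.nil_eq_ints.symm] at this
  rw [this, Val.tail_cons, PSR.backSolve]
  simp [hd, encPositions, encInts]

lemma run_fourierMotzkin {S : List Row} {d : ℕ} (hS : HasWidth d S) (hs : ρ vSys = encRows S)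
    (hd : ρ vPos = encPositions d) : (fourierMotzkin.run ρ).1 =
      open Classical in
      if ∀ r ∈ PSR.elim^[d] S, ¬ 0 < r.1 then
        Val.ofList ((PSR.backSolve S d).map fun z => .cons (.int z) (.int 1)) else .nil := by
  have key : ∀ t : List ℤ, (t.map Val.int).foldr (fun e acc => .cons (.cons e (.int 1)) acc) .nil =
      Val.ofList (t.map fun z => .cons (.int z) (.int 1)) := by
    intro t
    induction t with
    | nil => rfl
    | cons a t ih => rw [List.map_cons, List.foldr_cons, ih]; rfl
  rw [fourierMotzkin, run_bind_fst, run_buildStack hS hs hd, run_ifNil_fst]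
  refine if_congr (isNil_strictRows (S := PSR.elim^[d] S)
    (by simp [head_encStack, -List.headD_eq_head?_getD, headD_stack])) ?_ rfl
  rw [run_loop_fst, run_backSolve hS (by simp) (by simpa using hd)]
  simp only [Val.toList_ints, run_cons_fst, run_var_fst, run_lit_fst, run_nil_fst, ne_eq,
    Nat.reduceEqDiff, not_false_eq_true, Function.update_of_ne, Function.update_self, key]

lemma polyTime_fourierMotzkin (d : ℕ) :
    PolyTime (fun ρ => (ρ vPos).toList.length ≤ d) {vPos, vSys} fourierMotzkin := by
  have hpos : ∀ {H : Env → Prop}, PolyTime H {vPos, vSys} (var vPos) := polyTime_var (by simp)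
  have hbuild : PolyTime (fun ρ => (ρ vPos).toList.length ≤ d) {vPos, vSys} buildStack := by
    refine PolyTime.loop_of_length_le (H' := fun _ => True) d hpos
      ((polyTime_var (by simp)).cons polyTime_nil)
      ((polyTime_elim (polyTime_var (by simp)).head ?_).cons (polyTime_var (by simp)))
      (fun _ _ _ _ _ => trivial) fun ρ h => h
    simp [vSys]
  refine PolyTime.bind (H' := fun ρ => (ρ vPos).toList.length ≤ d) hbuild ?_ (by simp)
  have hback : PolyTime (fun ρ => (ρ vPos).toList.length ≤ d) {21, vPos, vSys} backSolve := by
    have h22 : ∀ {H : Env → Prop} (W : Set ℕ), PolyTime H (insert 22 W) (var 22) :=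
      fun W => polyTime_var (by simp)
    refine (PolyTime.loop_of_length_le (H' := fun _ => True) d (polyTime_var (by simp))
      ((polyTime_var (by simp)).tail.cons polyTime_nil)
      ((h22 _).head.tail.cons (polyTime_extend (h22 _).head.head
        ((h22 _).tail.mono (Set.subset_insert _ _)) ?_))
      (fun _ _ _ _ _ => trivial) fun ρ h => h).tail
    simp [vSys]
  refine PolyTime.ifNil ?_ ?_ polyTime_nil
  · exact PolyTime.loop (H' := fun _ => True) (polyTime_var (by simp)).head polyTime_nil
      ((polyTime_var (by simp)).head.ifPos (polyTime_nil.cons (polyTime_var (by simp)))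
        (polyTime_var (by simp)))
      (Grows.ifPos (Grows.cons polyTime_nil grows_var) grows_var) (by simp) (by simp)
      fun _ _ _ _ _ => trivial
  · have he : ∀ {H : Env → Prop} (W : Set ℕ), PolyTime H (insert 23 W)
        (cons (var 23) (lit 1)) := fun W => (polyTime_var (by simp)).cons (polyTime_lit 1)
    exact PolyTime.loop (H' := fun _ => True) hback polyTime_nil
      (((he _).mono (Set.subset_insert _ _)).cons (polyTime_var (by simp)))
      (Grows.cons (he _) grows_var) (by simp) (by simp) fun _ _ _ _ _ => trivial

end Prog

/-- An inequality as a row of coefficients. -/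
def Ineq.toRow {d : ℕ} (c : Ineq d) : Row := (if c.strict then 1 else 0, List.ofFn c.coeff)

lemma encSystem_eq {d : ℕ} (S : List (Ineq d)) : encSystem S = encRows (S.map Ineq.toRow) := by
  rw [encSystem, encRows, List.map_map]
  congr 1
  refine List.map_congr_left fun c _ => ?_
  simp [Ineq.toRow, encRow, encInts, Val.ints, List.map_ofFn, Function.comp_def]

lemma Row.dot_ofFn {R : Type*} [CommRing R] {d : ℕ} (a : Fin d → ℤ) (s : Fin d → R) :
    Row.dot (List.ofFn a) (List.ofFn s) = ∑ j, (a j : R) * s j := by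
  induction d with
  | zero => simp
  | succ d ih => rw [List.ofFn_succ, List.ofFn_succ, Row.dot_cons, Fin.sum_univ_succ, ih]

lemma Ineq.sat_toRow_iff {d : ℕ} (c : Ineq d) (s : Fin d → ℝ) :
    c.toRow.Sat (List.ofFn s) ↔ c.Holds s := by
  obtain ⟨_ | _, a⟩ := c
  · simp [Row.Sat, Ineq.toRow, Ineq.Holds, Row.dot_ofFn]
  · simp only [Row.Sat, Ineq.toRow, Ineq.Holds, Row.dot_ofFn, if_true, zero_lt_one, true_imp_iff]
    exact ⟨fun h => h.2, fun h => ⟨h.le, h⟩⟩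

lemma Row.Sat.holds {d : ℕ} {c : Ineq d} {t : List ℤ} (h : c.toRow.Sat t) (hlen : t.length = d) :
    c.Holds fun j => (t.get (j.cast hlen.symm) : ℝ) := by
  subst hlen
  have hcast : ∀ (u t : List ℤ), Row.dot u (t.map (Int.cast : ℤ → ℝ)) = (Row.dot u t : ℤ) := by
    intro u
    induction u with
    | nil => simp
    | cons a u ih => intro t; cases t <;> simp [ih]
  rw [← Ineq.sat_toRow_iff]
  have e : (List.ofFn fun j : Fin t.length => (t.get j : ℝ)) = t.map (Int.cast : ℤ → ℝ) := by
    conv_rhs => rw [← List.ofFn_get t, List.map_ofFn]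
    rfl
  simp only [Fin.cast_eq_self]
  rw [e, Row.Sat, hcast]
  exact ⟨by exact_mod_cast h.1, fun hp => by exact_mod_cast h.2 hp⟩

/-- Fourier–Motzkin elimination is a linear programming subroutine that is efficient in fixed
dimension. -/
theorem isLPSolver_fourierMotzkin : IsLPSolver Prog.fourierMotzkin := by
  intro d _
  obtain ⟨q, hq⟩ := Prog.polyTime_fourierMotzkin d
  refine ⟨q.comp (.X + .C (encPositions d).size), fun S ρ hd hs => ?_⟩
  have hw : HasWidth d (S.map Ineq.toRow) := by
    intro r hr
    obtain ⟨c, -, rfl⟩ := List.mem_map.1 hr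
    simp [Ineq.toRow]
  have hrun := Prog.run_fourierMotzkin hw (hs.trans (encSystem_eq S)) hd
  refine ⟨fun hinf => ?_, fun hfeas => ?_, ?_⟩
  · rw [hrun, if_neg]
    intro hns
    obtain ⟨hsat, hlen⟩ := sat_backSolve hw hns
    exact hinf ⟨_, fun c hc => (hsat _ (List.mem_map_of_mem hc)).holds hlen⟩
  · obtain ⟨s, hs⟩ := hfeas
    have hns := not_strict_of_sat hw (s := List.ofFn s) (by simp) (by
      intro r hr
      obtain ⟨c, hc, rfl⟩ := List.mem_map.1 hr
      exact (c.sat_toRow_iff s).2 (hs c hc))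
    rw [hrun, if_pos hns]
    obtain ⟨hsat, hlen⟩ := sat_backSolve hw hns
    generalize backSolve (S.map Ineq.toRow) d = t at hsat hlen
    subst hlen
    refine ⟨fun j => (t.get j : ℚ), fun c hc => ?_, ?_⟩
    · simpa using (hsat _ (List.mem_map_of_mem hc)).holds rfl
    · rw [encRats]
      congr 1
      conv_lhs => rw [← List.ofFn_get t, List.map_ofFn]
      simp [encRat, Function.comp_def]
  · refine (hq ρ ((encSystem S).size + (encPositions d).size) ?_ ?_).trans (by simp)
    · simp [hd, encPositions, encInts]
    · simp [hd, hs]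

end PSR

namespace PSR

/-! ### The number of regions -/

open Finset in
/-- The sets of linear forms that are positive at a point of `ℝ^d` do not shatter any set of more
than `d` forms: for a linear relation between `d + 1` forms, no point separates the forms with
positive coefficients from the others. -/
lemma card_le_of_shatters {α : Type*} [DecidableEq α] {d : ℕ} (δ : α → Fin d → ℝ) (C : Finset α)
    (𝒜 : Finset (Finset α))
    (h𝒜 : ∀ u ∈ 𝒜, ∃ s : Fin d → ℝ, ∀ c, c ∈ u ↔ c ∈ C ∧ 0 < ∑ j, δ c j * s j)
    {t : Finset α} (ht : 𝒜.Shatters t) : t ⊆ C ∧ #t ≤ d := by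
  have htC : t ⊆ C := by
    obtain ⟨u, hu, htu⟩ := ht.exists_superset
    obtain ⟨s, hs⟩ := h𝒜 u hu
    exact fun c hc => ((hs c).1 (htu hc)).1
  refine ⟨htC, ?_⟩
  by_contra! hd
  have hdep : ¬ LinearIndependent ℝ fun c : t => δ c := by
    intro h
    have := h.fintype_card_le_finrank
    simp at this
    omega
  obtain ⟨g, hg, hne⟩ : ∃ g : t → ℝ, ∑ c, g c • δ c = 0 ∧ ∃ c, 0 < g c := by
    obtain ⟨g, hg, c, hc⟩ := Fintype.not_linearIndependent_iff.1 hdep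
    rcases lt_or_gt_of_ne hc with h | h
    · exact ⟨-g, by simpa using hg, c, by simpa using h⟩
    · exact ⟨g, hg, c, h⟩
  obtain ⟨c₀, hc₀⟩ := hne
  classical
  -- a point at which exactly those forms of `t` are positive that have positive coefficients
  obtain ⟨u, hu, htu⟩ := ht.subset_iff.1
    (show (Finset.univ.filter fun c : t => 0 < g c).map (Function.Embedding.subtype _) ⊆ t from by
      intro c hc
      simp only [Finset.mem_map, Function.Embedding.subtype_apply] at hc
      obtain ⟨c', -, rfl⟩ := hc
      exact c'.2)
  obtain ⟨s, hs⟩ := h𝒜 u hu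
  have hu' : ∀ c : t, c.1 ∈ u ↔ 0 < g c := by
    intro c
    have := Finset.ext_iff.1 htu c.1
    simpa using this
  have hval : ∀ c : t, 0 < g c ↔ 0 < ∑ j, δ c j * s j := by
    intro c
    rw [← hu', hs]
    simp [htC c.2]
  have hzero : ∑ c : t, g c * ∑ j, δ c j * s j = 0 := by
    calc ∑ c : t, g c * ∑ j, δ c j * s j = ∑ j, (∑ c : t, g c • δ c) j * s j := by
          simp only [Finset.mul_sum, Finset.sum_apply, Pi.smul_apply, smul_eq_mul, Finset.sum_mul]
          rw [Finset.sum_comm]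
          simp only [mul_assoc]
      _ = 0 := by rw [hg]; simp
  have hnonneg : ∀ c ∈ (Finset.univ : Finset t), 0 ≤ g c * ∑ j, δ c j * s j := by
    intro c _
    rcases lt_or_ge 0 (g c) with h | h
    · exact mul_nonneg h.le ((hval c).1 h).le
    · exact mul_nonneg_of_nonpos_of_nonpos h
        (not_lt.1 fun h' => absurd ((hval c).2 h') (not_lt.2 h))
  have := (Finset.sum_eq_zero_iff_of_nonneg hnonneg).1 hzero c₀ (Finset.mem_univ _)
  exact (mul_pos hc₀ ((hval c₀).1 hc₀)).ne' this

open Finset in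
/-- The number of sign patterns of `m` linear forms on `ℝ^d` is polynomial in `m`, by the
Sauer–Shelah lemma. -/
lemma card_patterns_le {α : Type*} [DecidableEq α] {d : ℕ} (δ : α → Fin d → ℝ) (C : Finset α)
    (𝒜 : Finset (Finset α))
    (h𝒜 : ∀ u ∈ 𝒜, ∃ s : Fin d → ℝ, ∀ c, c ∈ u ↔ c ∈ C ∧ 0 < ∑ j, δ c j * s j) :
    #𝒜 ≤ (d + 1) * (#C + 1) ^ d := by
  have hsub : 𝒜.shatterer ⊆ (Finset.range (d + 1)).biUnion fun k => C.powersetCard k := by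
    intro t ht
    obtain ⟨h1, h2⟩ := card_le_of_shatters δ C 𝒜 h𝒜 (mem_shatterer.1 ht)
    simp only [Finset.mem_biUnion, Finset.mem_range, Finset.mem_powersetCard]
    exact ⟨#t, by omega, h1, rfl⟩
  calc #𝒜 ≤ #𝒜.shatterer := card_le_card_shatterer 𝒜
    _ ≤ #((Finset.range (d + 1)).biUnion fun k => C.powersetCard k) := card_le_card hsub
    _ ≤ #(Finset.range (d + 1)) * (#C + 1) ^ d := by
      refine Finset.card_biUnion_le_card_mul _ _ _ fun k hk => ?_
      rw [Finset.card_powersetCard]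
      calc (#C).choose k ≤ (#C) ^ k := Nat.choose_le_pow _ _
        _ ≤ (#C + 1) ^ k := Nat.pow_le_pow_left (by omega) k
        _ ≤ (#C + 1) ^ d := Nat.pow_le_pow_right (by omega) (by simpa [Nat.lt_succ_iff] using hk)
    _ = (d + 1) * (#C + 1) ^ d := by simp

/-! ### Constraints, regions and pools -/

/-- A constraint, as seen by the algorithm: a weight and an integer vector. -/
structure Constr (d : ℕ) where
  weight : ℚ
  vec : Fin d → ℤ

namespace Constr

variable {d : ℕ}

/-- The representation of a constraint in the input. -/
def enc (c : Constr d) : Val := .cons (encRat c.weight) (encInts c.vec)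

/-- The scoring vector `s` satisfies the constraint. -/
def Pos (c : Constr d) (s : Fin d → ℝ) : Prop := 0 < ∑ j, (c.vec j : ℝ) * s j

open Classical in
/-- The total weight of the constraints in the list that `s` satisfies. -/
noncomputable def gain (L : List (Constr d)) (s : Fin d → ℝ) : ℝ :=
  (L.map fun c => if c.Pos s then (c.weight : ℝ) else 0).sum

/-- The representation of a list of constraints in the input. -/
def encList (L : List (Constr d)) : Val := Val.ofList (L.map enc)

/-- The inequality `δ · s > 0`. -/
def yes (c : Constr d) : Ineq d := ⟨true, c.vec⟩

/-- The inequality `δ · s ≤ 0`. -/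
def no (c : Constr d) : Ineq d := ⟨false, fun j => -c.vec j⟩

lemma yes_holds (c : Constr d) (s : Fin d → ℝ) : c.yes.Holds s ↔ c.Pos s := by
  simp [yes, Ineq.Holds, Pos]

lemma no_holds (c : Constr d) (s : Fin d → ℝ) : c.no.Holds s ↔ ¬ c.Pos s := by
  simp [no, Ineq.Holds, Pos]

end Constr

/-- A region of the pool: its gain, as a fraction, and the inequalities that define it. -/
structure Region (d : ℕ) where
  num : ℤ
  den : ℤ
  sys : List (Ineq d)

namespace Region

variable {d : ℕ}

/-- The representation of a region in the pool. -/
def enc (R : Region d) : Val := .cons (.cons (.int R.num) (.int R.den)) (encSystem R.sys)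

/-- The point `s` lies in the region. -/
def Mem (R : Region d) (s : Fin d → ℝ) : Prop := ∀ c ∈ R.sys, c.Holds s

/-- The region is non-empty. -/
def Feasible (R : Region d) : Prop := ∃ s, R.Mem s

/-- Addition of a weight to the gain. -/
def addWeight (R : Region d) (w : ℚ) : Region d :=
  ⟨R.num * w.den + w.num * R.den, R.den * w.den, R.sys⟩

/-- Addition of an inequality. -/
def inter (R : Region d) (c : Ineq d) : Region d := ⟨R.num, R.den, c :: R.sys⟩

@[simp] lemma mem_inter (R : Region d) (c : Ineq d) (s : Fin d → ℝ) :
    (R.inter c).Mem s ↔ c.Holds s ∧ R.Mem s := by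
  simp [inter, Mem]

@[simp] lemma mem_addWeight (R : Region d) (w : ℚ) (s : Fin d → ℝ) :
    (R.addWeight w).Mem s ↔ R.Mem s := Iff.rfl

/-- The regions that replace `R` when the constraint `c` is considered. -/
noncomputable def split (c : Constr d) (R : Region d) : List (Region d) :=
  open Classical in
  if (R.inter c.yes).Feasible then
    if (R.inter c.no).Feasible then
      [(R.inter c.yes).addWeight c.weight, R.inter c.no]
    else [R.addWeight c.weight]
  else [R]

/-- The constraint `c` holds on the region `R'` or fails on it, and the gain of `R'` arises from
that of `R` accordingly. -/
def Decides (c : Constr d) (R R' : Region d) : Prop :=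
  ((∀ s, R'.Mem s → c.Pos s) ∧ R'.num = (R.addWeight c.weight).num ∧
      R'.den = (R.addWeight c.weight).den) ∨
    ((∀ s, R'.Mem s → ¬ c.Pos s) ∧ R'.num = R.num ∧ R'.den = R.den)

lemma of_mem_split {c : Constr d} {R R' : Region d} (hR : R.Feasible) (h : R' ∈ split c R) :
    R'.Feasible ∧ (∀ s, R'.Mem s → R.Mem s) ∧ Decides c R R' ∧
      (R'.sys = R.sys ∨ R'.sys = c.yes :: R.sys ∨ R'.sys = c.no :: R.sys) := by
  rw [split] at h
  split_ifs at h with h1 h2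
  · simp only [List.mem_cons, List.not_mem_nil, or_false] at h
    rcases h with rfl | rfl
    · refine ⟨h1, fun s hs => ?_, Or.inl ⟨fun s hs => ?_, rfl, rfl⟩, Or.inr (Or.inl rfl)⟩
      · rw [mem_addWeight, mem_inter] at hs; exact hs.2
      · rw [mem_addWeight, mem_inter, Constr.yes_holds] at hs; exact hs.1
    · refine ⟨h2, fun s hs => ?_, Or.inr ⟨fun s hs => ?_, rfl, rfl⟩, Or.inr (Or.inr rfl)⟩
      · rw [mem_inter] at hs; exact hs.2
      · rw [mem_inter, Constr.no_holds] at hs; exact hs.1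
  · rw [List.mem_singleton] at h
    subst h
    refine ⟨hR, fun s hs => hs, Or.inl ⟨fun s hs => ?_, rfl, rfl⟩, Or.inl rfl⟩
    by_contra hneg
    exact h2 ⟨s, (mem_inter _ _ _).2 ⟨(c.no_holds s).2 hneg, hs⟩⟩
  · rw [List.mem_singleton] at h
    subst h
    refine ⟨hR, fun s hs => hs, Or.inr ⟨fun s hs hpos => ?_, rfl, rfl⟩, Or.inl rfl⟩
    exact h1 ⟨s, (mem_inter _ _ _).2 ⟨(c.yes_holds s).2 hpos, hs⟩⟩

lemma exists_mem_split (c : Constr d) {R : Region d} {s : Fin d → ℝ} (hs : R.Mem s) :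
    ∃ R' ∈ split c R, R'.Mem s := by
  rw [split]
  split_ifs with h1 h2
  · by_cases h : c.Pos s
    · exact ⟨(R.inter c.yes).addWeight c.weight, by simp,
        (mem_inter _ _ _).2 ⟨(c.yes_holds s).2 h, hs⟩⟩
    · exact ⟨R.inter c.no, by simp, (mem_inter _ _ _).2 ⟨(c.no_holds s).2 h, hs⟩⟩
  · exact ⟨R.addWeight c.weight, by simp, hs⟩
  · exact ⟨R, by simp, hs⟩

end Region

/-- Two regions are separated by one of the constraints in the list. -/
def Separated {d : ℕ} (L : List (Constr d)) (R R' : Region d) : Prop :=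
  ∀ s s', R.Mem s → R'.Mem s' → ∃ c ∈ L, ¬ (c.Pos s ↔ c.Pos s')

/-- The initial system: row `i` is `s_i - s_{i+1} ≥ 0` or, for the last row, `s_d ≥ 0`.  The
conditions are those that the program evaluates on the positions `i + 1` and `j + 1`. -/
def initialSystem (d : ℕ) : List (Ineq d) :=
  List.ofFn fun i : Fin d => ⟨false, fun j : Fin d =>
    if 0 < (j : ℤ) + 1 - ((i : ℤ) + 1) then
      if 0 < (j : ℤ) + 1 - ((i : ℤ) + 1) - 1 then 0 else -1
    else if 0 < (i : ℤ) + 1 - ((j : ℤ) + 1) then 0 else 1⟩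

/-- The pool after the constraints in the list have been considered, last one first. -/
noncomputable def pool {d : ℕ} (L : List (Constr d)) : List (Region d) :=
  L.foldr (fun c P => P.flatMap (Region.split c)) [⟨0, 1, initialSystem d⟩]

lemma sum_initialSystem {n : ℕ} (i : Fin (n + 1)) (s : Fin (n + 1) → ℝ) :
    ∑ j : Fin (n + 1), ((if 0 < (j : ℤ) + 1 - ((i : ℤ) + 1) then
      if 0 < (j : ℤ) + 1 - ((i : ℤ) + 1) - 1 then 0 else -1
    else if 0 < (i : ℤ) + 1 - ((j : ℤ) + 1) then 0 else 1 : ℤ) : ℝ) * s j =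
      s i - if h : i.1 + 1 < n + 1 then s ⟨i + 1, h⟩ else 0 := by
  have e : ∀ j : Fin (n + 1), ((if 0 < (j : ℤ) + 1 - ((i : ℤ) + 1) then
      if 0 < (j : ℤ) + 1 - ((i : ℤ) + 1) - 1 then 0 else -1
    else if 0 < (i : ℤ) + 1 - ((j : ℤ) + 1) then 0 else 1 : ℤ) : ℝ) * s j =
      (if i = j then s j else 0) - if i.1 + 1 = j.1 then s j else 0 := by
    intro j
    simp only [Fin.ext_iff]
    split_ifs <;> first | omega | simp
  rw [Finset.sum_congr rfl fun j _ => e j, Finset.sum_sub_distrib, Finset.sum_ite_eq]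
  simp only [Finset.mem_univ, if_true]
  congr 1
  split_ifs with h
  · rw [Finset.sum_eq_single ⟨i + 1, h⟩]
    · simp
    · intro j _ hj
      rw [if_neg]
      intro hij
      exact hj (Fin.ext hij.symm)
    · simp
  · refine Finset.sum_eq_zero fun j _ => if_neg ?_
    have := j.2
    omega

lemma holds_initialSystem {d : ℕ} (hd : 0 < d) (s : Fin d → ℝ) :
    (∀ c ∈ initialSystem d, c.Holds s) ↔ IsScoringVector s := by
  obtain ⟨n, rfl⟩ : ∃ n, d = n + 1 := ⟨d - 1, by omega⟩
  have h1 : (∀ c ∈ initialSystem (n + 1), c.Holds s) ↔ ∀ i : Fin (n + 1),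
      0 ≤ s i - if h : i.1 + 1 < n + 1 then s ⟨i + 1, h⟩ else 0 := by
    rw [initialSystem, List.forall_mem_ofFn_iff]
    refine forall_congr' fun i => ?_
    simp only [Ineq.Holds, Bool.false_eq_true, if_false]
    rw [sum_initialSystem]
  rw [h1]
  constructor
  · intro h
    have ha : Antitone s := by
      rw [Fin.antitone_iff_succ_le]
      intro i
      have := h i.castSucc
      rw [dif_pos (by simp)] at this
      have e : (⟨(i.castSucc : ℕ) + 1, by simp⟩ : Fin (n + 1)) = i.succ := rfl
      rw [e] at this
      linarith
    refine ⟨ha, fun j => ?_⟩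
    have := h (Fin.last n)
    rw [dif_neg (by simp)] at this
    linarith [ha (Fin.le_last j)]
  · rintro ⟨ha, hn⟩ i
    split_ifs with h
    · have : s ⟨i + 1, h⟩ ≤ s i := ha (by rw [Fin.le_def]; simp)
      linarith
    · simpa using hn i

/-- The invariant of the algorithm: the regions of the pool cover all scoring vectors, they are
separated by the constraints considered so far, and on each of them the gain is the recorded one. -/
structure PoolInvariant {d : ℕ} (L : List (Constr d)) (P : List (Region d)) : Prop where
  scoring : ∀ R ∈ P, ∀ s, R.Mem s → IsScoringVector s
  feasible : ∀ R ∈ P, R.Feasible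
  cover : ∀ s, IsScoringVector s → ∃ R ∈ P, R.Mem s
  separated : P.Pairwise (Separated L)
  den_pos : ∀ R ∈ P, 0 < R.den
  gain : ∀ R ∈ P, ∀ s, R.Mem s → (R.num : ℝ) = R.den * Constr.gain L s

lemma poolInvariant_nil {d : ℕ} (hd : 0 < d) :
    PoolInvariant (d := d) [] [⟨0, 1, initialSystem d⟩] where
  scoring := by simp [Region.Mem, holds_initialSystem hd]
  feasible := by
    simp only [List.mem_singleton, forall_eq, Region.Feasible, Region.Mem, holds_initialSystem hd]
    exact ⟨0, fun _ _ _ => le_refl _, fun _ => le_refl _⟩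
  cover := by simp [Region.Mem, holds_initialSystem hd]
  separated := by simp
  den_pos := by simp
  gain := by simp [Constr.gain]

lemma PoolInvariant.cons {d : ℕ} {L : List (Constr d)} {P : List (Region d)}
    (h : PoolInvariant L P) (c : Constr d) :
    PoolInvariant (c :: L) (P.flatMap (Region.split c)) where
  scoring R' hR' s hs := by
    obtain ⟨R, hR, hR'⟩ := List.mem_flatMap.1 hR'
    exact h.scoring R hR s ((Region.of_mem_split (h.feasible R hR) hR').2.1 s hs)
  feasible R' hR' := by
    obtain ⟨R, hR, hR'⟩ := List.mem_flatMap.1 hR'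
    exact (Region.of_mem_split (h.feasible R hR) hR').1
  cover s hs := by
    obtain ⟨R, hR, hRs⟩ := h.cover s hs
    obtain ⟨R', hR', hRs'⟩ := Region.exists_mem_split c hRs
    exact ⟨R', List.mem_flatMap.2 ⟨R, hR, hR'⟩, hRs'⟩
  separated := by
    rw [List.pairwise_flatMap]
    constructor
    · intro R _
      rw [Region.split]
      split_ifs
      · rw [List.pairwise_pair]
        intro s s' hs hs'
        rw [Region.mem_addWeight, Region.mem_inter, Constr.yes_holds] at hs
        rw [Region.mem_inter, Constr.no_holds] at hs'
        exact ⟨c, by simp, fun hiff => hs'.1 (hiff.1 hs.1)⟩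
      · simp
      · simp
    · refine h.separated.imp_of_mem fun {R₁ R₂} h₁ h₂ hsep R₁' h₁' R₂' h₂' s s' hs hs' => ?_
      obtain ⟨c', hc', hne⟩ := hsep s s' ((Region.of_mem_split (h.feasible R₁ h₁) h₁').2.1 s hs)
        ((Region.of_mem_split (h.feasible R₂ h₂) h₂').2.1 s' hs')
      exact ⟨c', List.mem_cons_of_mem _ hc', hne⟩
  den_pos R' hR' := by
    obtain ⟨R, hR, hR'⟩ := List.mem_flatMap.1 hR'
    have hpos := h.den_pos R hR
    rcases (Region.of_mem_split (h.feasible R hR) hR').2.2.1 with ⟨-, -, e⟩ | ⟨-, -, e⟩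
    · rw [e]; exact mul_pos hpos (by exact_mod_cast c.weight.den_pos)
    · rwa [e]
  gain R' hR' s hs := by
    obtain ⟨R, hR, hR'⟩ := List.mem_flatMap.1 hR'
    obtain ⟨-, hsub, hdec, -⟩ := Region.of_mem_split (h.feasible R hR) hR'
    have hg := h.gain R hR s (hsub s hs)
    classical
    have hcons : Constr.gain (c :: L) s =
        (if c.Pos s then (c.weight : ℝ) else 0) + Constr.gain L s := by
      simp only [Constr.gain, List.map_cons, List.sum_cons]
    rw [hcons]
    rcases hdec with ⟨hp, e1, e2⟩ | ⟨hp, e1, e2⟩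
    · rw [if_pos (hp s hs), e1, e2]
      have hw : (c.weight : ℝ) * c.weight.den = c.weight.num := by
        exact_mod_cast Rat.mul_den_eq_num c.weight
      simp only [Region.addWeight]
      push_cast
      rw [hg, ← hw]
      ring
    · rw [if_neg (hp s hs), e1, e2, zero_add, hg]

lemma poolInvariant_pool {d : ℕ} (hd : 0 < d) (L : List (Constr d)) : PoolInvariant L (pool L) := by
  induction L with
  | nil => exact poolInvariant_nil hd
  | cons c L ih => exact ih.cons c

/-- Regions of the pool have different sign patterns, of which there are few. -/
lemma PoolInvariant.length_le {d : ℕ} {L : List (Constr d)} {P : List (Region d)}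
    (h : PoolInvariant L P) : P.length ≤ (d + 1) * (L.length + 1) ^ d := by
  classical
  choose! pt hpt using h.feasible
  let pat : Region d → Finset (Constr d) := fun R => L.toFinset.filter fun c => c.Pos (pt R)
  have hnodup : (P.map pat).Nodup := by
    rw [List.Nodup, List.pairwise_map]
    refine h.separated.imp_of_mem fun {R R'} hR hR' hsep heq => ?_
    obtain ⟨c, hc, hne⟩ := hsep _ _ (hpt R hR) (hpt R' hR')
    have := Finset.ext_iff.1 heq c
    simp only [pat, Finset.mem_filter, List.mem_toFinset, hc, true_and] at this
    exact hne this
  have hcard := card_patterns_le (fun (c : Constr d) j => (c.vec j : ℝ)) L.toFinset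
    (P.map pat).toFinset (by
      intro u hu
      simp only [List.mem_toFinset, List.mem_map] at hu
      obtain ⟨R, -, rfl⟩ := hu
      exact ⟨pt R, fun c => by simp only [pat, Finset.mem_filter]; rfl⟩)
  rw [List.toFinset_card_of_nodup hnodup, List.length_map] at hcard
  refine hcard.trans (Nat.mul_le_mul_left _ (Nat.pow_le_pow_left ?_ _))
  have := L.toFinset_card_le
  omega

end PSR

namespace PSR

/-! ### Sizes of pools -/

lemma Val.size_ofList_le {L : List Val} {B : ℕ} (h : ∀ e ∈ L, e.size ≤ B) :
    (Val.ofList L).size ≤ 1 + L.length * (B + 1) := by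
  induction L with
  | nil => simp [Val.ofList, Val.size]
  | cons e L ih =>
    have h1 := ih fun e he => h e (List.mem_cons_of_mem _ he)
    have h2 := h e (by simp)
    simp only [Val.ofList, Val.size, List.length_cons]
    rw [add_mul]; omega

lemma size_encInts_neg {d : ℕ} (a : Fin d → ℤ) :
    (encInts fun j => -a j).size = (encInts a).size := by
  simp only [encInts]
  induction d with
  | zero => simp
  | succ d ih =>
    simp only [List.ofFn_succ, Val.ofList, Val.size, Int.natAbs_neg]
    rw [ih fun j => a j.succ]

/-- The representation of a pool. -/
def encPool {d : ℕ} (P : List (Region d)) : Val := Val.ofList (P.map Region.enc)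

lemma length_le_size_encList {d : ℕ} (L : List (Constr d)) :
    L.length ≤ (Constr.encList L).size := by
  have := Val.length_toList_le (Constr.encList L)
  simpa [Constr.encList] using this

/-- Fractions are not reduced, but numerators and denominators have linear size; every constraint
adds at most one inequality, which is not larger than the constraint. -/
lemma size_of_mem_pool {d : ℕ} (hd : 0 < d) (L : List (Constr d)) {R : Region d}
    (hR : R ∈ pool L) :
    (Val.int R.num).size ≤ (Constr.encList L).size + 1 ∧
    (Val.int R.den).size ≤ (Constr.encList L).size + 1 ∧
    (encSystem R.sys).size ≤ (encSystem (initialSystem d)).size + (Constr.encList L).size := by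
  induction L generalizing R with
  | nil =>
    obtain rfl : R = ⟨0, 1, initialSystem d⟩ := by simpa [pool] using hR
    simp [Constr.encList, Val.ofList, Val.size]
  | cons c L ih =>
    obtain ⟨R₀, hR₀, hR⟩ := List.mem_flatMap.1 (show R ∈ (pool L).flatMap (Region.split c) from hR)
    obtain ⟨h1, h2, h3⟩ := ih hR₀
    obtain ⟨-, -, hdec, hsys⟩ :=
      Region.of_mem_split ((poolInvariant_pool hd L).feasible R₀ hR₀) hR
    have hc : (Constr.encList (c :: L)).size = (Val.int c.weight.num).size +
        (Val.int c.weight.den).size + 1 + (encInts c.vec).size + 1 +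
        (Constr.encList L).size + 1 := rfl
    have hw := Val.one_le_size (.int c.weight.num)
    have hw' := Val.one_le_size (.int c.weight.den)
    have hfrac : (Val.int R.num).size ≤ (Constr.encList (c :: L)).size + 1 ∧
        (Val.int R.den).size ≤ (Constr.encList (c :: L)).size + 1 := by
      rcases hdec with ⟨-, e1, e2⟩ | ⟨-, e1, e2⟩
      · rw [e1, e2]
        have m1 := Val.size_int_mul_le R₀.num c.weight.den
        have m2 := Val.size_int_mul_le c.weight.num R₀.den
        have m3 := Val.size_int_mul_le R₀.den c.weight.den
        have m4 := Val.size_int_add_le (R₀.num * c.weight.den) (c.weight.num * R₀.den)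
        simp only [Region.addWeight]
        omega
      · rw [e1, e2]; omega
    refine ⟨hfrac.1, hfrac.2, ?_⟩
    rcases hsys with e | e | e
    · rw [e]; omega
    · have : (encSystem (c.yes :: R₀.sys)).size =
          2 + (encInts c.vec).size + 1 + (encSystem R₀.sys).size + 1 := by
        simp [encSystem, Constr.yes, Val.ofList, Val.size]
      rw [e, this]; omega
    · have : (encSystem (c.no :: R₀.sys)).size =
          1 + (encInts c.vec).size + 1 + (encSystem R₀.sys).size + 1 := by
        rw [← size_encInts_neg c.vec]
        simp [encSystem, Constr.no, Val.ofList, Val.size]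
      rw [e, this]; omega

/-- In fixed dimension, the size of the pool is polynomial in the size of the constraints. -/
lemma size_pool_le {d : ℕ} (hd : 0 < d) : ∃ q : Polynomial ℕ, ∀ L : List (Constr d),
    (encPool (pool L)).size ≤ q.eval (Constr.encList L).size := by
  refine ⟨1 + (.C (d + 1) * (.X + 1) ^ d) *
    (3 * .X + .C ((encSystem (initialSystem d)).size + 5)), fun L => ?_⟩
  have h1 : ∀ e ∈ (pool L).map Region.enc, e.size ≤
      3 * (Constr.encList L).size + ((encSystem (initialSystem d)).size + 4) := by
    intro e he
    obtain ⟨R, hR, rfl⟩ := List.mem_map.1 he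
    obtain ⟨h1, h2, h3⟩ := size_of_mem_pool hd L hR
    have : R.enc.size = (Val.int R.num).size + (Val.int R.den).size + 1 +
      (encSystem R.sys).size + 1 := rfl
    omega
  have h2 := Val.size_ofList_le h1
  have h3 := (poolInvariant_pool hd L).length_le
  have h4 := Nat.pow_le_pow_left (Nat.add_le_add_right (length_le_size_encList L) 1) d
  have h5 := h3.trans (Nat.mul_le_mul_left (d + 1) h4)
  rw [List.length_map] at h2
  refine h2.trans ?_
  simp only [Polynomial.eval_add, Polynomial.eval_mul, Polynomial.eval_one, Polynomial.eval_C,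
    Polynomial.eval_pow, Polynomial.eval_X, Polynomial.eval_ofNat]
  exact Nat.add_le_add_left (Nat.mul_le_mul h5 (by omega)) 1

/-! ### The results of the parts of the algorithm -/

namespace Prog

variable {H H' : Env → Prop} {V : Set ℕ} {p l init body lp : Prog} {ρ : Env} {x y d : ℕ}

lemma run_initialRegion (hd : ρ vPos = encPositions d) :
    (initialRegion.run ρ).1 = encSystem (initialSystem d) := by
  have hpos : encPositions d = Val.ints (List.ofFn fun j : Fin d => (j : ℤ) + 1) := by
    simp [encPositions, encInts, Val.ints, List.map_ofFn, Function.comp_def]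
  have hrow : ∀ (z : ℤ) (L : List ℤ), (L.map Val.int).foldr (fun e acc =>
      .cons (if 0 < e.toInt - z then if 0 < e.toInt - z - 1 then .int 0 else .int (-1)
        else if 0 < z - e.toInt then .int 0 else .int 1) acc) .nil =
      Val.ofList (L.map fun e => .int (if 0 < e - z then if 0 < e - z - 1 then 0 else -1
        else if 0 < z - e then 0 else 1)) := by
    intro z L
    induction L with
    | nil => rfl
    | cons a L ih =>
      rw [List.map_cons, List.foldr_cons, ih, List.map_cons, Val.ofList]
      congr 1
      simp only [apply_ite Val.int]
      rfl
  have hrows : ∀ (f : ℤ → Val) (L : List ℤ), (L.map Val.int).foldr (fun e acc =>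
      .cons (.cons (.int 0) (f e.toInt)) acc) .nil =
      Val.ofList (L.map fun e => .cons (.int 0) (f e)) := by
    intro f L
    induction L with
    | nil => rfl
    | cons a L ih => rw [List.map_cons, List.foldr_cons, ih]; rfl
  simp only [initialRegion, run_loop_fst, run_var_fst, run_nil_fst, run_cons_fst, run_lit_fst,
    run_ifPos_fst, run_sub_fst, vI, vAcc, vJ, vRow, vPos, ne_eq, Nat.reduceEqDiff,
    not_false_eq_true, Function.update_of_ne, Function.update_self, Val.toInt_int] at hd ⊢
  simp only [hd, hpos, Val.toList_ints, hrow]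
  refine (hrows (fun z => Val.ofList ((List.ofFn fun j : Fin d => (j : ℤ) + 1).map fun e =>
    .int (if 0 < e - z then if 0 < e - z - 1 then 0 else -1 else if 0 < z - e then 0 else 1)))
    _).trans ?_
  simp [initialSystem, encSystem, encInts, List.map_ofFn, Function.comp_def]

lemma run_negVec {a : Fin d → ℤ} (hp : (p.run ρ).1 = encInts a) :
    ((negVec p).run ρ).1 = encInts fun j => -a j := by
  have key : ∀ L : List ℤ,
      (L.map Val.int).foldr (fun e acc => .cons (.int (0 - e.toInt)) acc) .nil =
      Val.ofList (L.map fun z => Val.int (-z)) := by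
    intro L
    induction L with
    | nil => rfl
    | cons a L ih => rw [List.map_cons, List.foldr_cons, ih]; simp [Val.ofList]
  have h := key (List.ofFn a)
  rw [negVec, run_loop_fst, hp]
  simp only [List.map_ofFn, Function.comp_def] at h
  simp only [encInts, Val.toList_ofList, run_cons_fst, run_sub_fst, run_lit_fst, run_var_fst,
    run_nil_fst, vJ, vRow, ne_eq, Nat.reduceEqDiff,
    not_false_eq_true, Function.update_of_ne, Function.update_self, Val.toInt_int, h]

/-- The feasibility test fails exactly for systems without real solutions. -/
lemma isNil_feasible (hd : 0 < d) (hlp : IsLPSolver lp) {S : List (Ineq d)}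
    (hpos : ρ vPos = encPositions d) (hp : (p.run ρ).1 = encSystem S) :
    ((feasible lp p).run ρ).1.isNil = true ↔ ¬ ∃ s : Fin d → ℝ, ∀ c ∈ S, c.Holds s := by
  obtain ⟨q, hq⟩ := hlp d hd
  obtain ⟨h1, h2, -⟩ := hq S (Function.update ρ vSys (p.run ρ).1) (by simpa [vSys] using hpos)
    (by simpa using hp)
  rw [feasible, run_bind_fst]
  constructor
  · intro hnil hfeas
    obtain ⟨s, -, hs⟩ := h2 hfeas
    rw [hs] at hnil
    obtain ⟨n, rfl⟩ : ∃ n, d = n + 1 := ⟨d - 1, by omega⟩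
    simp [encRats, Val.ofList, Val.isNil] at hnil
  · intro h
    rw [h1 h]; rfl

lemma run_step (hd : 0 < d) (hlp : IsLPSolver lp) {P : List (Region d)} {c : Constr d}
    (hpos : ρ vPos = encPositions d) (hpool : ρ vPool = encPool P) (hc : ρ vConstr = c.enc) :
    ((step lp).run ρ).1 = encPool (P.flatMap (Region.split c)) := by
  have hflat : ∀ P : List (Region d), P.flatMap (Region.split c) =
      P.foldr (fun R acc => Region.split c R ++ acc) [] := by
    intro P
    induction P with
    | nil => rfl
    | cons R P ih => rw [List.flatMap_cons, List.foldr_cons, ih]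
  rw [step, run_loop_fst, run_var_fst, hpool, encPool, Val.toList_ofList, hflat]
  refine foldr_map_encode (enc' := encPool) (b := []) fun R _ acc => ?_
  set ρ₁ := loopEnv ρ vReg vAcc R.enc (encPool acc) with hρ₁
  have e1 : ((cons (cons (lit 1) (tail (var vConstr))) (tail (var vReg))).run ρ₁).1 =
      encSystem (R.inter c.yes).sys := by
    simp [hρ₁, vReg, vAcc, vConstr, hc]
    rfl
  rw [run_bind_fst, e1]
  set ρ₂ := Function.update ρ₁ vRegYes (encSystem (R.inter c.yes).sys) with hρ₂
  have e2 : ((cons (cons (lit 0) (negVec (tail (var vConstr)))) (tail (var vReg))).run ρ₂).1 =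
      encSystem (R.inter c.no).sys := by
    have := run_negVec (ρ := ρ₂) (p := tail (var vConstr)) (a := c.vec)
      (by simp [hρ₂, hρ₁, vReg, vAcc, vConstr, vRegYes, hc]; rfl)
    rw [run_cons_fst, run_cons_fst, this]
    simp [hρ₂, hρ₁, vReg, vAcc, vRegYes]
    rfl
  rw [run_bind_fst, e2]
  set ρ₃ := Function.update ρ₂ vRegNo (encSystem (R.inter c.no).sys) with hρ₃
  have hyes := isNil_feasible (ρ := ρ₃) (p := var vRegYes) hd hlp
    (by simp [hρ₃, hρ₂, hρ₁, vReg, vAcc, vRegYes, vRegNo, hpos])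
    (S := (R.inter c.yes).sys) (by simp [hρ₃, hρ₂, vRegYes, vRegNo])
  rw [run_bind_fst]
  set ρ₄ := Function.update ρ₃ vYes ((feasible lp (var vRegYes)).run ρ₃).1 with hρ₄
  have hno := isNil_feasible (ρ := ρ₄) (p := var vRegNo) hd hlp
    (by simp [hρ₄, hρ₃, hρ₂, hρ₁, vReg, vAcc, vRegYes, vRegNo, vYes, hpos])
    (S := (R.inter c.no).sys) (by simp [hρ₄, hρ₃, vRegNo, vYes])
  rw [run_bind_fst]
  set ρ₅ := Function.update ρ₄ vNo ((feasible lp (var vRegNo)).run ρ₄).1 with hρ₅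
  have hvYes : ρ₅ vYes = ((feasible lp (var vRegYes)).run ρ₃).1 := by
    simp [hρ₅, hρ₄, vYes, vNo]
  have hvNo : ρ₅ vNo = ((feasible lp (var vRegNo)).run ρ₄).1 := by simp [hρ₅]
  have hvReg : ρ₅ vReg = R.enc := by
    simp [hρ₅, hρ₄, hρ₃, hρ₂, hρ₁, vReg, vAcc, vRegYes, vRegNo, vYes, vNo]
  have hvAcc : ρ₅ vAcc = encPool acc := by
    simp [hρ₅, hρ₄, hρ₃, hρ₂, hρ₁, vAcc, vRegYes, vRegNo, vYes, vNo]
  have hvConstr : ρ₅ vConstr = c.enc := by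
    simp [hρ₅, hρ₄, hρ₃, hρ₂, hρ₁, vReg, vConstr, vAcc, vRegYes, vRegNo, vYes, vNo, hc]
  have hvRegYes : ρ₅ vRegYes = encSystem (R.inter c.yes).sys := by
    simp [hρ₅, hρ₄, hρ₃, hρ₂, vRegYes, vRegNo, vYes, vNo]
  have hvRegNo : ρ₅ vRegNo = encSystem (R.inter c.no).sys := by
    simp [hρ₅, hρ₄, hρ₃, vRegNo, vYes, vNo]
  simp only [addFrac, run_ifNil_fst, run_cons_fst, run_var_fst, run_head_fst, run_tail_fst,
    run_add_fst, run_mul_fst, hvYes, hvNo, hvReg, hvAcc, hvConstr, hvRegYes, hvRegNo]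
  rw [Region.split]
  by_cases hy : (R.inter c.yes).Feasible
  · rw [if_neg (by rw [hyes]; exact not_not.2 hy), if_pos hy]
    by_cases hn : (R.inter c.no).Feasible
    · rw [if_neg (by rw [hno]; exact not_not.2 hn), if_pos hn]
      rfl
    · rw [if_pos (by rw [hno]; exact hn), if_neg hn]
      rfl
  · rw [if_pos (by rw [hyes]; exact hy), if_neg hy]
    rfl

/-- The best region of the pool has maximum gain. -/
lemma run_bestRegion {P : List (Region d)} (hP : P ≠ []) (hden : ∀ R ∈ P, 0 < R.den)
    (hpool : ρ vPool = encPool P) : ∃ R ∈ P, (bestRegion.run ρ).1 = R.enc ∧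
      ∀ R' ∈ P, R'.num * R.den ≤ R.num * R'.den := by
  obtain ⟨R₀, hR₀⟩ : ∃ R₀, P.head? = some R₀ := by
    cases P with
    | nil => exact absurd rfl hP
    | cons R P => exact ⟨R, rfl⟩
  have hR₀P : R₀ ∈ P := List.mem_of_mem_head? hR₀
  let better : Region d → Region d → Region d := fun R B =>
    if 0 < R.num * B.den - B.num * R.den then R else B
  have key : ∀ Q : List (Region d), (∀ R ∈ Q, R ∈ P) → Q.foldr better R₀ ∈ P ∧
      ∀ R' ∈ Q, R'.num * (Q.foldr better R₀).den ≤ (Q.foldr better R₀).num * R'.den := by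
    intro Q
    induction Q with
    | nil => intro _; simpa using hR₀P
    | cons R Q ih =>
      intro hQ
      obtain ⟨h1, h2⟩ := ih fun R hR => hQ R (List.mem_cons_of_mem _ hR)
      rw [List.foldr_cons]
      generalize Q.foldr better R₀ = B at *
      have hRP := hQ R (by simp)
      simp only [better]
      split_ifs with h
      · refine ⟨hRP, fun R' hR' => ?_⟩
        rcases List.mem_cons.1 hR' with rfl | hR'
        · rfl
        · have d1 := hden R hRP
          have d2 := hden B h1
          have d3 := hden R' (hQ R' (List.mem_cons_of_mem _ hR'))
          refine le_of_mul_le_mul_right ?_ d2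
          have := mul_le_mul_of_nonneg_right (h2 R' hR') d1.le
          have := mul_lt_mul_of_pos_right (sub_pos.1 h) d3
          linarith
      · refine ⟨h1, fun R' hR' => ?_⟩
        rcases List.mem_cons.1 hR' with rfl | hR'
        · linarith
        · exact h2 R' hR'
  refine ⟨P.foldr better R₀, (key P fun _ h => h).1, ?_, (key P fun _ h => h).2⟩
  rw [bestRegion, run_loop_fst, run_var_fst, run_head_fst, run_var_fst, hpool]
  have hhead : (encPool P).head = R₀.enc := by
    cases P with
    | nil => exact absurd rfl hP
    | cons R P => simp at hR₀; subst hR₀; rfl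
  rw [hhead, encPool, Val.toList_ofList]
  refine foldr_map_encode fun R _ B => ?_
  simp only [run_ifPos_fst, run_sub_fst, run_mul_fst, run_head_fst, run_tail_fst, run_var_fst,
    vReg, vBest, ne_eq, Nat.reduceEqDiff, not_false_eq_true, Function.update_of_ne,
    Function.update_self, better]
  change (if 0 < R.num * B.den - B.num * R.den then _ else _) = _
  split_ifs <;> rfl

/-- The loop over the constraints yields the pool. -/
lemma run_loop_step (hd : 0 < d) (hlp : IsLPSolver lp) (hpos : ρ vPos = encPositions d) :
    ∀ L : List (Constr d), (L.map Constr.enc).foldr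
      (fun e acc => ((step lp).run (loopEnv ρ vConstr vPool e acc)).1)
      ((cons (cons (cons (lit 0) (lit 1)) initialRegion) nil).run ρ).1 = encPool (pool L) := by
  intro L
  induction L with
  | nil =>
    rw [List.map_nil, List.foldr_nil, run_cons_fst, run_cons_fst, run_initialRegion hpos]
    rfl
  | cons c L ih =>
    rw [List.map_cons, List.foldr_cons, ih, run_step (P := pool L) (c := c) hd hlp
      (by simp [vPos, vConstr, vPool] at hpos ⊢; exact hpos) (by simp)
      (by simp [vConstr, vPool])]
    rfl

end Prog

end PSR

namespace PSR

/-! ### The running time of the algorithm -/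

namespace Prog

variable {H H' : Env → Prop} {V : Set ℕ} {p l init body lp : Prog} {ρ : Env} {x y d : ℕ}

/-- A loop runs in polynomial time if its accumulators have polynomial size. -/
lemma PolyTime.loop_of_size_le (hl : PolyTime H V l) (hi : PolyTime H V init)
    (hb : PolyTime H' (insert y (insert x V)) body) (A : Polynomial ℕ)
    (hA : ∀ ρ n, H ρ → (∀ x ∈ V, (ρ x).size ≤ n) → ∀ e L, (e :: L) <:+ (l.run ρ).1.toList →
      ∀ acc, acc = L.foldr (fun e acc => (body.run (loopEnv ρ x y e acc)).1) (init.run ρ).1 →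
        acc.size ≤ A.eval n ∧ H' (loopEnv ρ x y e acc)) :
    PolyTime H V (Prog.loop x y l init body) := by
  obtain ⟨a, ha⟩ := hl
  obtain ⟨i, hi⟩ := hi
  obtain ⟨b, hb⟩ := hb
  let B : Polynomial ℕ := b.comp (.X + a + A) + a + A + 1
  refine ⟨2 * a + 2 * i + a * B + 1, fun ρ n hρ hn => ?_⟩
  have h1 := ha ρ n hρ hn
  have h2 := hi ρ n hρ hn
  have h3 := size_run_le l ρ
  have h4 := size_run_le init ρ
  have hlen := length_toList_le_run l ρ
  have key := Val.loop_invariant (f := fun e acc => body.run (loopEnv ρ x y e acc))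
    (init := init.run ρ) (v := (l.run ρ).1) (B := B.eval n)
    (fun L acc => acc = L.foldr (fun e acc => (body.run (loopEnv ρ x y e acc)).1) (init.run ρ).1)
    rfl ?_
  · have := Nat.mul_le_mul_right (B.eval n) (hlen.trans h1)
    have := key.2
    simp only [run, loopEnv, Polynomial.eval_add, Polynomial.eval_mul, Polynomial.eval_ofNat,
      Polynomial.eval_one] at *
    omega
  · intro e L acc hs hacc
    obtain ⟨h5, h6⟩ := hA ρ n hρ hn e L hs acc hacc
    refine ⟨by rw [List.foldr_cons, ← hacc], ?_⟩
    have h7 := size_mem_toList_le_run (hs.subset (by simp) : e ∈ (l.run ρ).1.toList)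
    have := hb (loopEnv ρ x y e acc) (n + a.eval n + A.eval n) h6
      (size_update_le (size_update_le (fun z hz => (hn z hz).trans (by omega)) (by omega))
        (by omega))
    simp only [B, Polynomial.eval_add, Polynomial.eval_comp, Polynomial.eval_X,
      Polynomial.eval_one]
    omega

lemma polyTime_feasible (hd : 0 < d) (hlp : IsLPSolver lp) (hp : PolyTime H V p)
    (hpos : ∀ ρ, H ρ → ρ vPos = encPositions d)
    (hsys : ∀ ρ, H ρ → ∃ S : List (Ineq d), (p.run ρ).1 = encSystem S) :
    PolyTime H V (feasible lp p) := by
  obtain ⟨q, hq⟩ := hlp d hd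
  refine PolyTime.bind (H' := fun ρ => ρ vPos = encPositions d ∧
    ∃ S : List (Ineq d), ρ vSys = encSystem S) hp ⟨q, ?_⟩ ?_
  · rintro ρ n ⟨h1, S, h2⟩ hn
    refine (hq S ρ h1 h2).2.2.trans (polynomial_eval_mono q ?_)
    rw [← h2]
    exact hn vSys (by simp)
  · intro ρ hρ
    obtain ⟨S, hS⟩ := hsys ρ hρ
    exact ⟨by simpa [vSys] using hpos ρ hρ, S, by simp [hS]⟩

lemma polyTime_addFrac {p q : Prog} (hp : PolyTime H V p) (hq : PolyTime H V q) :
    PolyTime H V (addFrac p q) :=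
  ((hp.head.mul hq.tail).add (hq.head.mul hp.tail)).cons (hp.tail.mul hq.tail)

lemma polyTime_negVec (hp : PolyTime H V p) (hV : vRow ∉ V) : PolyTime H V (negVec p) := by
  have he : ∀ {H : Env → Prop}, PolyTime H (insert vJ V) (sub (lit 0) (var vJ)) :=
    (polyTime_lit 0).sub (polyTime_var (by simp))
  exact PolyTime.loop (H' := fun _ => True) hp polyTime_nil
    ((he.mono (Set.subset_insert _ _)).cons (polyTime_var (by simp)))
    (Grows.cons he grows_var) (by simp) hV fun _ _ _ _ _ => trivial

lemma polyTime_initialRegion (hV : vPos ∈ V) (hV' : ∀ x ∈ V, x < 6) :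
    PolyTime H V initialRegion := by
  have hAcc : vAcc ∉ V := fun h => absurd (hV' _ h) (by decide)
  have hRow : vRow ∉ V := fun h => absurd (hV' _ h) (by decide)
  have he : ∀ {H : Env → Prop}, PolyTime H (insert vJ (insert vI V))
      (ifPos (sub (var vJ) (var vI))
        (ifPos (sub (sub (var vJ) (var vI)) (lit 1)) (lit 0) (lit (-1)))
        (ifPos (sub (var vI) (var vJ)) (lit 0) (lit 1))) := by
    intro H
    have hj : PolyTime H (insert vJ (insert vI V)) (var vJ) := polyTime_var (by simp)
    have hi : PolyTime H (insert vJ (insert vI V)) (var vI) := polyTime_var (by simp)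
    exact (hj.sub hi).ifPos (((hj.sub hi).sub (polyTime_lit 1)).ifPos (polyTime_lit 0)
      (polyTime_lit (-1))) ((hi.sub hj).ifPos (polyTime_lit 0) (polyTime_lit 1))
  have hrow : ∀ {H : Env → Prop}, PolyTime H (insert vI V)
      (cons (lit 0) (loop vJ vRow (var vPos) nil (cons (ifPos (sub (var vJ) (var vI))
        (ifPos (sub (sub (var vJ) (var vI)) (lit 1)) (lit 0) (lit (-1)))
        (ifPos (sub (var vI) (var vJ)) (lit 0) (lit 1))) (var vRow)))) :=
    (polyTime_lit 0).cons (PolyTime.loop (H' := fun _ => True) (polyTime_var (by simp [hV]))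
      polyTime_nil ((he.mono (Set.subset_insert _ _)).cons (polyTime_var (by simp)))
      (Grows.cons he grows_var) (by simp) (by simp [hRow]) fun _ _ _ _ _ => trivial)
  exact PolyTime.loop (H' := fun _ => True) (polyTime_var hV) polyTime_nil
    ((hrow.mono (Set.subset_insert _ _)).cons (polyTime_var (by simp)))
    (Grows.cons hrow grows_var) (by simp) hAcc fun _ _ _ _ _ => trivial

lemma polyTime_bestRegion (hV : vPool ∈ V) (hV' : vBest ∉ V) : PolyTime H V bestRegion := by
  have hr : ∀ {H : Env → Prop}, PolyTime H (insert vBest (insert vReg V)) (var vReg) :=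
    polyTime_var (by simp)
  have hb : ∀ {H : Env → Prop}, PolyTime H (insert vBest (insert vReg V)) (var vBest) :=
    polyTime_var (by simp)
  exact PolyTime.loop (H' := fun _ => True) (polyTime_var hV) (polyTime_var hV).head
    (((hr.head.head.mul hb.head.tail).sub (hb.head.head.mul hr.head.tail)).ifPos hr hb)
    (Grows.ifPos (polyTime_var (by simp)).grows grows_var) (by simp) hV' fun _ _ _ _ _ => trivial

/-- One step of the algorithm is polynomial in the sizes of the pool and of the constraint. -/
lemma polyTime_step (hd : 0 < d) (hlp : IsLPSolver lp) (h4 : vPool ∈ V) (h3 : vConstr ∈ V)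
    (hV : ∀ x ∈ V, x < 5) :
    PolyTime (fun ρ => ρ vPos = encPositions d ∧ (∃ P : List (Region d), ρ vPool = encPool P) ∧
      ∃ c : Constr d, ρ vConstr = c.enc) V (step lp) := by
  have hAcc : vAcc ∉ V := fun h => absurd (hV _ h) (by decide)
  have hRow : vRow ∉ V := fun h => absurd (hV _ h) (by decide)
  -- The preconditions at the places where the subroutine is called.
  let H₁ : Env → Prop := fun ρ => ρ vPos = encPositions d ∧
    (∃ R : Region d, ρ vReg = R.enc) ∧ ∃ c : Constr d, ρ vConstr = c.enc
  let H₂ : Env → Prop := fun ρ => H₁ ρ ∧ ∃ S : List (Ineq d), ρ vRegYes = encSystem S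
  let H₃ : Env → Prop := fun ρ => ρ vPos = encPositions d ∧
    (∃ S : List (Ineq d), ρ vRegYes = encSystem S) ∧ ∃ S : List (Ineq d), ρ vRegNo = encSystem S
  have hY : ∀ {H : Env → Prop} {W : Set ℕ}, vConstr ∈ W → vReg ∈ W → PolyTime H W
      (cons (cons (lit 1) (tail (var vConstr))) (tail (var vReg))) := fun h h' =>
    ((polyTime_lit 1).cons (polyTime_var h).tail).cons (polyTime_var h').tail
  have hN : ∀ {H : Env → Prop} {W : Set ℕ}, vConstr ∈ W → vReg ∈ W → vRow ∉ W → PolyTime H W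
      (cons (cons (lit 0) (negVec (tail (var vConstr)))) (tail (var vReg))) := fun h h' h'' =>
    ((polyTime_lit 0).cons (polyTime_negVec (polyTime_var h).tail h'')).cons (polyTime_var h').tail
  have hFY : ∀ {W : Set ℕ}, vRegYes ∈ W → PolyTime H₃ W (feasible lp (var vRegYes)) := fun h =>
    polyTime_feasible hd hlp (polyTime_var h) (fun ρ h => h.1) fun ρ h => h.2.1
  have hFN : ∀ {W : Set ℕ}, vRegNo ∈ W → PolyTime H₃ W (feasible lp (var vRegNo)) := fun h =>
    polyTime_feasible hd hlp (polyTime_var h) (fun ρ h => h.1) fun ρ h => h.2.2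
  have hA : ∀ {H : Env → Prop} {W : Set ℕ}, vConstr ∈ W → vReg ∈ W → PolyTime H W
      (addFrac (head (var vReg)) (head (var vConstr))) := fun h h' =>
    polyTime_addFrac (polyTime_var h').head (polyTime_var h).head
  have hH₂ : ∀ ρ, H₁ ρ → H₂ (Function.update ρ vRegYes
      ((cons (cons (lit 1) (tail (var vConstr))) (tail (var vReg))).run ρ).1) := by
    rintro ρ ⟨h1, ⟨R, hR⟩, c, hc⟩
    refine ⟨⟨by simpa [vRegYes] using h1, ⟨R, by simpa [vReg, vRegYes] using hR⟩, c,
      by simpa [vConstr, vRegYes] using hc⟩, (R.inter c.yes).sys, ?_⟩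
    simp [hR, hc]
    rfl
  have hH₃ : ∀ ρ, H₂ ρ → H₃ (Function.update ρ vRegNo
      ((cons (cons (lit 0) (negVec (tail (var vConstr)))) (tail (var vReg))).run ρ).1) := by
    rintro ρ ⟨⟨h1, ⟨R, hR⟩, c, hc⟩, S, hS⟩
    refine ⟨by simpa [vRegNo] using h1, ⟨S, by simpa [vRegNo, vRegYes] using hS⟩,
      (R.inter c.no).sys, ?_⟩
    have := run_negVec (ρ := ρ) (p := tail (var vConstr)) (a := c.vec)
      (by simp [hc]; rfl)
    simp [hR, this]
    rfl
  have hH₃' : ∀ (v : Val) ρ, H₃ ρ → H₃ (Function.update ρ vYes v) := by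
    rintro v ρ ⟨h1, ⟨S, hS⟩, T, hT⟩
    exact ⟨by simpa [vYes] using h1, ⟨S, by simpa [vRegYes, vYes] using hS⟩, T,
      by simpa [vRegNo, vYes] using hT⟩
  refine PolyTime.loop (H' := H₁) (polyTime_var h4) polyTime_nil ?_ ?_ (by simp) hAcc ?_
  · refine PolyTime.bind (H' := H₂) (hY (by simp [h3]) (by simp)) ?_ hH₂
    refine PolyTime.bind (H' := H₃) (hN (by simp [h3]) (by simp) (by simp [hRow])) ?_ hH₃
    refine PolyTime.bind (H' := H₃) (hFY (by simp)) ?_ fun ρ h => hH₃' _ ρ h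
    refine PolyTime.bind (H' := fun _ => True) (hFN (by simp)) ?_ fun _ _ => trivial
    refine PolyTime.ifNil (polyTime_var (by simp))
      ((polyTime_var (by simp)).cons (polyTime_var (by simp)))
      (PolyTime.ifNil (polyTime_var (by simp)) ?_ ?_)
    · exact ((hA (by simp [h3]) (by simp)).cons (polyTime_var (by simp)).tail).cons
        (polyTime_var (by simp))
    · exact ((hA (by simp [h3]) (by simp)).cons (polyTime_var (by simp))).cons
        (((polyTime_var (by simp)).head.cons (polyTime_var (by simp))).cons
          (polyTime_var (by simp)))
  · refine Grows.bind (H' := H₂) (hY (by simp [h3]) (by simp)) ?_ (by simp) hH₂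
    refine Grows.bind (H' := H₃) (hN (by simp [h3]) (by simp) (by simp [hRow])) ?_ (by simp) hH₃
    refine Grows.bind (H' := H₃) (hFY (by simp)) ?_ (by simp) fun ρ h => hH₃' _ ρ h
    refine Grows.bind (H' := fun _ => True) (hFN (by simp)) ?_ (by simp) fun _ _ => trivial
    refine Grows.ifNil (Grows.cons (polyTime_var (by simp)) grows_var) (Grows.ifNil ?_ ?_)
    · exact Grows.cons ((hA (by simp [h3]) (by simp)).cons (polyTime_var (by simp)).tail) grows_var
    · exact Grows.cons ((hA (by simp [h3]) (by simp)).cons (polyTime_var (by simp)))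
        (Grows.cons ((polyTime_var (by simp)).head.cons (polyTime_var (by simp))) grows_var)
  · rintro ρ ⟨h1, ⟨P, hP⟩, c, hc⟩ e he acc
    rw [run_var_fst, hP, encPool, Val.toList_ofList] at he
    obtain ⟨R, -, rfl⟩ := List.mem_map.1 he
    exact ⟨by simpa [vReg, vAcc] using h1, ⟨R, by simp [vReg, vAcc]⟩, c,
      by simpa [vConstr, vReg, vAcc] using hc⟩

/-- The representation of an input. -/
def _root_.PSR.encInput (L : List (Constr d)) : Val := .cons (encPositions d) (Constr.encList L)

/-- The loop of `algorithm` over the constraints. -/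
def buildPool (lp : Prog) : Prog :=
  loop vConstr vPool (tail (var vInput)) (cons (cons (cons (lit 0) (lit 1)) initialRegion) nil)
    (step lp)

lemma run_buildPool (hd : 0 < d) (hlp : IsLPSolver lp) {L : List (Constr d)}
    (hin : ρ vInput = encInput L) (hpos : ρ vPos = encPositions d) :
    ((buildPool lp).run ρ).1 = encPool (pool L) := by
  rw [buildPool, run_loop_fst, run_tail_fst, run_var_fst, hin, encInput, Val.tail_cons,
    Constr.encList, Val.toList_ofList, run_loop_step hd hlp hpos]

lemma run_tail_bestRegion (hd : 0 < d) {L : List (Constr d)} (hpool : ρ vPool = encPool (pool L)) :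
    ∃ R ∈ pool L, ((tail bestRegion).run ρ).1 = encSystem R.sys ∧
      ∀ R' ∈ pool L, R'.num * R.den ≤ R.num * R'.den := by
  have hinv := poolInvariant_pool hd L
  have hne : pool L ≠ [] := by
    obtain ⟨R, hR, -⟩ := hinv.cover 0 ⟨fun _ _ _ => le_refl _, fun _ => le_refl _⟩
    exact List.ne_nil_of_mem hR
  obtain ⟨R, hR, e, hmax⟩ := run_bestRegion hne hinv.den_pos hpool
  exact ⟨R, hR, by rw [run_tail_fst, e]; rfl, hmax⟩

lemma polyTime_algorithm (hd : 0 < d) (hlp : IsLPSolver lp) :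
    PolyTime (fun ρ => ∃ L : List (Constr d), ρ vInput = encInput L) {vInput} (algorithm lp) := by
  refine PolyTime.bind (H' := fun ρ => (∃ L : List (Constr d), ρ vInput = encInput L) ∧
    ρ vPos = encPositions d) (polyTime_var (by simp)).head ?_ ?_
  swap
  · rintro ρ ⟨L, hL⟩
    exact ⟨⟨L, by simpa [vInput, vPos] using hL⟩, by simp [hL, encInput]⟩
  refine PolyTime.bind (p := buildPool lp) (H' := fun ρ => ρ vPos = encPositions d ∧
    ∃ L : List (Constr d), ρ vPool = encPool (pool L)) ?_ ?_ ?_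
  · obtain ⟨A, hA⟩ := size_pool_le hd
    refine PolyTime.loop_of_size_le (polyTime_var (by simp)).tail
      ((((polyTime_lit 0).cons (polyTime_lit 1)).cons
        (polyTime_initialRegion (by simp) (by simp [vInput]))).cons polyTime_nil)
      (polyTime_step hd hlp (by simp) (by simp) (by simp [vInput, vConstr, vPool])) A ?_
    rintro ρ n ⟨⟨L, hL⟩, hpos⟩ hn e M hM acc rfl
    rw [run_tail_fst, run_var_fst, hL, encInput, Val.tail_cons, Constr.encList,
      Val.toList_ofList] at hM
    obtain ⟨T, hT⟩ := hM
    obtain ⟨L₁, L₂, rfl, rfl, hM⟩ := List.map_eq_append_iff.1 hT.symm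
    obtain ⟨c, L', rfl, rfl, rfl⟩ := List.map_eq_cons_iff.1 hM
    rw [run_loop_step hd hlp hpos]
    refine ⟨(hA L').trans (polynomial_eval_mono A (le_trans ?_ (hn vInput (by simp)))),
      by simpa [vPos, vConstr, vPool] using hpos, ⟨pool L', by simp⟩, c, by simp [vConstr, vPool]⟩
    rw [hL]
    have happ : ∀ L₁ : List (Constr d),
        (Constr.encList L').size ≤ (Constr.encList (L₁ ++ c :: L')).size := by
      intro L₁
      induction L₁ with
      | nil =>
        simp only [Constr.encList, List.nil_append, List.map_cons, Val.ofList, Val.size]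
        omega
      | cons a L₁ ih =>
        simp only [Constr.encList, List.cons_append, List.map_cons, Val.ofList, Val.size] at ih ⊢
        omega
    have := happ L₁
    simp only [encInput, Val.size]
    omega
  · refine polyTime_feasible hd hlp (polyTime_bestRegion (by simp) (by simp [vInput])).tail
      (fun ρ h => h.1) ?_
    rintro ρ ⟨-, L, hL⟩
    obtain ⟨R, -, e, -⟩ := run_tail_bestRegion hd hL
    exact ⟨R.sys, e⟩
  · rintro ρ ⟨⟨L, hL⟩, hpos⟩
    exact ⟨by simpa [vPos, vPool] using hpos, L, by simp [run_buildPool hd hlp hL hpos]⟩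

/-- The output of the algorithm is a point of a region of maximum gain. -/
lemma run_algorithm (hd : 0 < d) (hlp : IsLPSolver lp) {L : List (Constr d)}
    (hin : ρ vInput = encInput L) :
    ∃ s : Fin d → ℚ, ((algorithm lp).run ρ).1 = encRats s ∧
      ∃ R ∈ pool L, R.Mem (fun j => (s j : ℝ)) ∧
        ∀ R' ∈ pool L, R'.num * R.den ≤ R.num * R'.den := by
  have e0 : ((head (var vInput)).run ρ).1 = encPositions d := by simp [hin, encInput]
  have e1 := run_buildPool (ρ := Function.update ρ vPos (encPositions d)) (L := L) hd hlp
    (by simpa [vInput, vPos] using hin) (by simp)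
  set ρ₂ := Function.update (Function.update ρ vPos (encPositions d)) vPool (encPool (pool L))
    with hρ₂
  obtain ⟨R, hR, e2, hmax⟩ := run_tail_bestRegion (ρ := ρ₂) (L := L) hd (by simp [hρ₂])
  have e3 : ((algorithm lp).run ρ).1 = (lp.run (Function.update ρ₂ vSys (encSystem R.sys))).1 := by
    rw [algorithm, run_bind_fst, e0, run_bind_fst]
    rw [buildPool] at e1
    rw [e1, feasible, run_bind_fst, e2]
  obtain ⟨q, hq⟩ := hlp d hd
  obtain ⟨-, h2, -⟩ := hq R.sys (Function.update ρ₂ vSys (encSystem R.sys))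
    (by simp [hρ₂, vPos, vSys, vPool]) (by simp)
  obtain ⟨s, hs, e4⟩ := h2 ((poolInvariant_pool hd L).feasible R hR)
  exact ⟨s, e3.trans e4, R, hR, hs, hmax⟩

end Prog

/-- Points of regions of maximum gain have maximum gain among all scoring vectors. -/
lemma PoolInvariant.gain_le {d : ℕ} {L : List (Constr d)} {P : List (Region d)}
    (h : PoolInvariant L P) {R : Region d} (hR : R ∈ P) {s t : Fin d → ℝ} (hs : R.Mem s)
    (hmax : ∀ R' ∈ P, R'.num * R.den ≤ R.num * R'.den) (ht : IsScoringVector t) :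
    Constr.gain L t ≤ Constr.gain L s := by
  obtain ⟨R', hR', ht'⟩ := h.cover t ht
  have h1 : (R'.num : ℝ) * R.den ≤ R.num * R'.den := by exact_mod_cast hmax R' hR'
  have h2 : (0 : ℝ) < R.den := by exact_mod_cast h.den_pos R hR
  have h3 : (0 : ℝ) < R'.den := by exact_mod_cast h.den_pos R' hR'
  rw [h.gain R hR s hs, h.gain R' hR' t ht'] at h1
  exact le_of_mul_le_mul_left (by linarith) (mul_pos h2 h3)

/-- A constraint of an instance, as seen by the algorithm. -/
noncomputable def Instance.constr {d : ℕ} {N A : Type*} [Fintype N] (I : Instance d N A)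
    (c : A × A) : Constr d := ⟨I.weight c, I.delta c⟩

lemma Instance.encode_eq {d : ℕ} {N A : Type*} [Fintype N] (I : Instance d N A)
    (l : List (A × A)) : I.encode l = encInput (l.map I.constr) := by
  simp [Instance.encode, encInput, Constr.encList, Function.comp_def, Constr.enc, Instance.constr]

lemma Instance.gain_eq {d : ℕ} {N A : Type*} [Fintype N] (I : Instance d N A)
    {l : List (A × A)} (hl : l.Nodup) (hmem : ∀ c, c ∈ l ↔ c ∈ I.constraints) (s : Fin d → ℝ) :
    I.gain s = Constr.gain (l.map I.constr) s := by
  classical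
  have e : I.constraints = l.toFinset := by ext c; simp [hmem]
  rw [Instance.gain, e, List.sum_toFinset _ hl, Constr.gain, List.map_map]
  rfl

end PSR

theorem mainTheorem2 :
    (∃ lp : PSR.Prog, PSR.IsLPSolver lp) ∧
    ∀ lp : PSR.Prog, PSR.IsLPSolver lp →
      ∀ d : ℕ, 2 ≤ d → ∃ p : Polynomial ℕ,
        ∀ (N A : Type*) [Fintype N] (I : PSR.Instance d N A)
          (l : List (A × A)), l.Nodup → (∀ c, c ∈ l ↔ c ∈ I.constraints) →
            (∃ s : Fin d → ℚ,
              (PSR.runAlgorithm lp (I.encode l)).1 = PSR.encRats s ∧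
              I.IsSolution fun j => (s j : ℝ)) ∧
            (PSR.runAlgorithm lp (I.encode l)).2 ≤ p.eval (I.encode l).size := by
  refine ⟨⟨_, PSR.isLPSolver_fourierMotzkin⟩, fun lp hlp d hd => ?_⟩
  have hd' : 0 < d := by omega
  obtain ⟨p, hp⟩ := PSR.Prog.polyTime_algorithm hd' hlp
  refine ⟨p, fun N A _ I l hl hmem => ?_⟩
  rw [I.encode_eq]
  constructor
  · obtain ⟨s, hs, R, hR, hRs, hmax⟩ := PSR.Prog.run_algorithm hd' hlp
      (ρ := Function.update (fun _ => .nil) PSR.vInput (PSR.encInput (l.map I.constr)))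
      (L := l.map I.constr) (by simp)
    have hinv := PSR.poolInvariant_pool hd' (l.map I.constr)
    refine ⟨s, hs, hinv.scoring R hR _ hRs, fun t ht => ?_⟩
    rw [I.gain_eq hl hmem, I.gain_eq hl hmem]
    exact hinv.gain_le hR hRs hmax ht
  · exact hp _ _ ⟨_, Function.update_self ..⟩ (by simp)
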